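/- Let $d\ge 1$, $\gamma>1$, $p\ge 0$, $T>0$. For the compressible Euler equations in $\mathbb R^d$ with conservative variables $\mathbf u=(\rho,\rho\mathbf V,\rho E)$, pressure $P=(\gamma-1)(\rho E-\tfrac12\rho|\mathbf V|^2)$ and fluxes $\mathbf F_j(\mathbf u)=(\rho V_j,\ \rho V_j\mathbf V+P\mathbf e_j,\ (\rho E+P)V_j)$, let $s=\log(P/\rho^\gamma)$, let $H(\mathbf u)=-\rho s/(\gamma-1)$ be the generalized entropy, let $$\boldsymbol v(\mathbf u)=\frac{\partial H}{\partial\mathbf u}=\Big(\frac{\gamma-s}{\gamma-1}-\beta\frac{|\mathbf V|^2}{2},\ \beta\mathbf V,\ -\beta\Big),\qquad \beta=\rho/P,$$ be the entropy variables, $\mathbf u(\boldsymbol v)$ the inverse map (defined for vectors with negative last component, called admissible), and $\boldsymbol\Psi=\rho\mathbf V$ the entropy potential. Let $\mathcal T_h$ be a finite conforming simplicial mesh of a periodic domain (one period of $\mathbb R^d/\Lambda$, $\Lambda$ a lattice of full rank), grouped into macro-elements. Let $\partial\mathcal T_h$ consist of the faces on the interfaces between macro-elements (including the periodically identified ones),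 each counted once from either side, with $\boldsymbol n$ the unit normal outward from the side in question. Let $\boldsymbol{\mathcal V}_h$ be the $\mathbb R^{d+2}$-valued functions that are continuous on each macro-element and polynomial of degree at most $p$ on each simplex, and $\boldsymbol{\mathcal M}_h$ the $\mathbb R^{d+2}$-valued functions on the interfaces between macro-elements, single-valued (also across periodic identifications), that are polynomial of degree at most $p$ on each face. Let $\widehat{\mathbf F}_h=\widehat{\mathbf F}(\widehat{\boldsymbol v}_h,\boldsymbol v_h;\boldsymbol n)$ be an inviscid numerical flux, and let $(\boldsymbol v_h(t),\widehat{\boldsymbol v}_h(t))\in\boldsymbol{\mathcal V}_h\times\boldsymbol{\mathcal M}_h$, $t\in[0,T]$, have admissible values, be such that $\boldsymbol v_h$ is differentiable in time and $\widehat{\mathbf F}_h$ is integrable on the faces, and solve the macro-element entropy-variable HDG discretization $$\Big(\frac{\partial\mathbf u(\boldsymbol v_h)}{\partial t},\boldsymbol w\Big)_{\mathcal T_h}-\big(\mathbf F(\mathbf u(\boldsymbol v_h)),\nabla\boldsymbol w\big)_{\mathcal T_h}+\big\langle\widehat{\mathbf F}_h,\boldsymbol w\big\rangle_{\partial\mathcal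 T_h}=0,\qquad \big\langle\widehat{\mathbf F}_h,\boldsymbol\mu\big\rangle_{\partial\mathcal T_h}=0$$ for all $\boldsymbol w\in\boldsymbol{\mathcal V}_h$, $\boldsymbol\mu\in\boldsymbol{\mathcal M}_h$ and $t\in[0,T]$. Write $[\![a]\!]=\widehat a-a$ and $\Psi_n=\boldsymbol\Psi\cdot\boldsymbol n$. 1. If $[\![\boldsymbol v_h]\!]^T\widehat{\mathbf F}_h-[\![\Psi_n]\!]=0$ (almost everywhere) on every face of $\partial\mathcal T_h$ at all times $t\in[0,T]$, then the scheme is entropy-conservative: the total entropy $\int_{\mathcal T_h}H(\mathbf u(\boldsymbol v_h(t)))$ has zero time derivative and is constant on $[0,T]$. 2. If $[\![\boldsymbol v_h]\!]^T\widehat{\mathbf F}_h-[\![\Psi_n]\!]\le 0$ (almost everywhere) on every face of $\partial\mathcal T_h$ at all times $t\in[0,T]$, then the scheme is entropy-stable: the total entropy has nonpositive time derivative and is non-increasing on $[0,T]$. -/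

import Mathlib

open MeasureTheory Set

noncomputable section

namespace EulerHDG

/-! ### Compressible Euler equations: states, fluxes, entropy -/

/-- Physical space `ℝ^d` with its Euclidean structure. -/
abbrev Space (d : ℕ) := EuclideanSpace ℝ (Fin d)

/-- State vectors in `ℝ^(d+2)`: component `0`, then `d` components, then the last component.
Used both for the conservative variables `(ρ, ρV, ρE)` and for the entropy variables. -/
abbrev State (d : ℕ) := Fin (d + 2) → ℝ

/-- The state `(a, b, c)` with `a c : ℝ` and `b ∈ ℝ^d`. -/
def mkState {d : ℕ} (a : ℝ) (b : Fin d → ℝ) (c : ℝ) : State d :=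
  Fin.cons a (Fin.snoc b c : Fin (d + 1) → ℝ)

/-- First component of a state vector. -/
def first {d : ℕ} (u : State d) : ℝ := u 0

/-- The `d` middle components of a state vector. -/
def middle {d : ℕ} (u : State d) (i : Fin d) : ℝ := u i.castSucc.succ

/-- Last component of a state vector. -/
def last {d : ℕ} (u : State d) : ℝ := u (Fin.last (d + 1))

@[simp] lemma first_mkState {d : ℕ} (a : ℝ) (b : Fin d → ℝ) (c : ℝ) :
    first (mkState a b c) = a := rfl

@[simp] lemma middle_mkState {d : ℕ} (a : ℝ) (b : Fin d → ℝ) (c : ℝ) (i : Fin d) :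
    middle (mkState a b c) i = b i := by
  simp [middle, mkState]

@[simp] lemma last_mkState {d : ℕ} (a : ℝ) (b : Fin d → ℝ) (c : ℝ) :
    last (mkState a b c) = c := by
  simp [last, mkState, ← Fin.succ_last]

lemma mkState_components {d : ℕ} (u : State d) :
    mkState (first u) (middle u) (last u) = u := by
  funext c
  refine Fin.cases rfl (fun j => ?_) c
  refine Fin.lastCases ?_ (fun i => ?_) j
  · simp [mkState, last]
  · simp [mkState, middle]

/-- Euclidean inner product of state vectors, `aᵀ b`. -/
def dot {d : ℕ} (a b : State d) : ℝ := ∑ c, a c * b c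

lemma dot_mkState {d : ℕ} (a c a' c' : ℝ) (b b' : Fin d → ℝ) :
    dot (mkState a b c) (mkState a' b' c') = a * a' + ∑ i, b i * b' i + c * c' := by
  simp [dot, mkState, Fin.sum_univ_succ (n := d + 1), Fin.sum_univ_castSucc (n := d), add_assoc]

/-- Velocity `V = (ρV)/ρ`. -/
def velocity {d : ℕ} (u : State d) (i : Fin d) : ℝ := middle u i / first u

/-- `V · V`. -/
def speedSq {d : ℕ} (u : State d) : ℝ := ∑ i, velocity u i ^ 2

/-- Pressure `P = (γ - 1) ρ e`, where `ρE = ρe + ρ V·V/2`. -/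
def pressure {d : ℕ} (γ : ℝ) (u : State d) : ℝ :=
  (γ - 1) * (last u - first u * speedSq u / 2)

/-- The inviscid flux in direction `j`: `(ρ V_j, ρ V_j V + P e_j, (ρE + P) V_j)`. -/
def flux {d : ℕ} (γ : ℝ) (u : State d) (j : Fin d) : State d :=
  mkState (first u * velocity u j)
    (fun i => first u * velocity u j * velocity u i + if i = j then pressure γ u else 0)
    ((last u + pressure γ u) * velocity u j)

/-- Physical conservative states: positive density and pressure. -/
def Physical {d : ℕ} (γ : ℝ) (u : State d) : Prop := 0 < first u ∧ 0 < pressure γ u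

/-- Specific entropy `s = log (P / ρ^γ)`. -/
def specificEntropy {d : ℕ} (γ : ℝ) (u : State d) : ℝ :=
  Real.log (pressure γ u / first u ^ γ)

/-- Generalized entropy function `H(u) = - ρ s / (γ - 1)`. -/
def entropy {d : ℕ} (γ : ℝ) (u : State d) : ℝ :=
  -(first u * specificEntropy γ u) / (γ - 1)

/-- Entropy variables
`v(u) = ∂H/∂u = ((γ - s)/(γ - 1) - β V·V/2, β V, -β)` with `β = ρ / P`. -/
def entropyVars {d : ℕ} (γ : ℝ) (u : State d) : State d :=
  mkState
    ((γ - specificEntropy γ u) / (γ - 1) - first u / pressure γ u * speedSq u / 2)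
    (fun i => first u / pressure γ u * velocity u i)
    (-(first u / pressure γ u))

/-- Entropy-variable vectors which are the image of a physical state, i.e. those with `-β < 0`
(see `entropyVars_consVars` and `admissible_entropyVars`). -/
def Admissible {d : ℕ} (v : State d) : Prop := last v < 0

/-- The inverse `u(v)` of the map `u ↦ v(u)`; see `consVars_entropyVars` and
`entropyVars_consVars`. Here `β = -v_last`, `V = v_mid / β`,
`s = γ - (γ - 1)(v_first + β V·V/2)`, `ρ = exp (-(s + log β)/(γ - 1))` and `P = ρ / β`. -/
def consVars {d : ℕ} (γ : ℝ) (v : State d) : State d :=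
  let β : ℝ := -last v
  let V : Fin d → ℝ := fun i => middle v i / β
  let q : ℝ := ∑ i, V i ^ 2
  let s : ℝ := γ - (γ - 1) * (first v + β * q / 2)
  let ρ : ℝ := Real.exp (-(s + Real.log β) / (γ - 1))
  mkState ρ (fun i => ρ * V i) (ρ / β / (γ - 1) + ρ * q / 2)

/-- Entropy potential `Ψ(v) = ρ V`; see `potential_eq`. -/
def potential {d : ℕ} (γ : ℝ) (v : State d) : Space d :=
  WithLp.toLp 2 fun j => first (consVars γ v) * velocity (consVars γ v) j

/-! Consistency of the definitions above. -/

lemma admissible_entropyVars {d : ℕ} {γ : ℝ} {u : State d} (hu : Physical γ u) :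
    Admissible (entropyVars γ u) := by
  have := div_pos hu.1 hu.2
  simpa [Admissible, entropyVars] using this

lemma physical_consVars {d : ℕ} {γ : ℝ} (hγ : 1 < γ) {v : State d} (hv : Admissible v) :
    Physical γ (consVars γ v) := by
  have hβ : 0 < -last v := by simpa [Admissible] using hv
  have hg : 0 < γ - 1 := by linarith
  refine ⟨by simpa [consVars] using Real.exp_pos _, ?_⟩
  simp only [pressure, speedSq, velocity, consVars, first_mkState, middle_mkState, last_mkState]
  simp only [mul_div_cancel_left₀ _ (Real.exp_pos _).ne']
  rw [add_sub_cancel_right]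
  have := Real.exp_pos (-(γ - (γ - 1) * (first v +
    -last v * (∑ i, (middle v i / -last v) ^ 2) / 2) + Real.log (-last v)) / (γ - 1))
  positivity

lemma consVars_entropyVars {d : ℕ} {γ : ℝ} (hγ : 1 < γ) {u : State d} (hu : Physical γ u) :
    consVars γ (entropyVars γ u) = u := by
  obtain ⟨hρ, hP⟩ := hu
  have hg : γ - 1 ≠ 0 := by linarith
  have hβ : first u / pressure γ u ≠ 0 := (div_pos hρ hP).ne'
  have hs : (γ - (γ - 1) * ((γ - specificEntropy γ u) / (γ - 1)
      - first u / pressure γ u * speedSq u / 2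
      + first u / pressure γ u * speedSq u / 2)) = specificEntropy γ u := by
    field_simp; ring
  have hr : Real.exp (-(specificEntropy γ u + Real.log (first u / pressure γ u)) / (γ - 1))
      = first u := by
    rw [specificEntropy, Real.log_div hP.ne' (Real.rpow_pos_of_pos hρ γ).ne',
      Real.log_rpow hρ, Real.log_div hρ.ne' hP.ne']
    have : -(Real.log (pressure γ u) - γ * Real.log (first u) +
        (Real.log (first u) - Real.log (pressure γ u))) / (γ - 1) = Real.log (first u) := by
      field_simp; ring
    rw [this, Real.exp_log hρ]
  have hq : ∑ i, (first u / pressure γ u * velocity u i / (first u / pressure γ u)) ^ 2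
      = speedSq u := by
    simp only [mul_div_cancel_left₀ _ hβ]; rfl
  conv_rhs => rw [← mkState_components u]
  simp only [consVars, entropyVars, first_mkState, middle_mkState, last_mkState, neg_neg]
  rw [hq, hs, hr]
  congr 1
  · funext i
    rw [mul_div_cancel_left₀ _ hβ, velocity, mul_div_cancel₀ _ hρ.ne']
  · rw [div_div_cancel₀ hρ.ne']
    simp only [pressure]
    field_simp; ring

lemma pressure_consVars {d : ℕ} {γ : ℝ} (hγ : 1 < γ) {v : State d} :
    pressure γ (consVars γ v) = first (consVars γ v) / -last v := by
  have hg : γ - 1 ≠ 0 := by linarith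
  simp only [pressure, speedSq, velocity, consVars, first_mkState, middle_mkState, last_mkState]
  simp only [mul_div_cancel_left₀ _ (Real.exp_pos _).ne']
  rw [add_sub_cancel_right, mul_div_cancel₀ _ hg]

lemma entropyVars_consVars {d : ℕ} {γ : ℝ} (hγ : 1 < γ) {v : State d} (hv : Admissible v) :
    entropyVars γ (consVars γ v) = v := by
  have hβ : 0 < -last v := by simpa [Admissible] using hv
  have hg : γ - 1 ≠ 0 := by linarith
  obtain ⟨hρ, hP⟩ := physical_consVars hγ hv
  have hb : first (consVars γ v) / pressure γ (consVars γ v) = -last v := by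
    rw [pressure_consVars hγ, div_div_cancel₀ hρ.ne']
  have hV : ∀ i, velocity (consVars γ v) i = middle v i / -last v := by
    intro i
    simp only [velocity, consVars, first_mkState, middle_mkState]
    rw [mul_div_cancel_left₀ _ (Real.exp_pos _).ne']
  have hs : specificEntropy γ (consVars γ v) = γ - (γ - 1) * (first v +
      -last v * speedSq (consVars γ v) / 2) := by
    have hl : Real.log (first (consVars γ v)) = -(γ - (γ - 1) * (first v +
        -last v * speedSq (consVars γ v) / 2) + Real.log (-last v)) / (γ - 1) := by
      simp only [speedSq, hV]
      simp only [consVars, first_mkState, Real.log_exp]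
    rw [specificEntropy, Real.log_div hP.ne' (Real.rpow_pos_of_pos hρ γ).ne',
      Real.log_rpow hρ, pressure_consVars hγ, Real.log_div hρ.ne' hβ.ne', hl]
    field_simp; ring
  conv_rhs => rw [← mkState_components v]
  simp only [entropyVars, hb, hs, hV, neg_neg]
  congr 1
  · field_simp; ring
  · funext i
    rw [mul_div_cancel₀ _ hβ.ne']

/-- `Ψ_j = F_jᵀ v - 𝓕_j`, where `𝓕_j = H V_j` is the entropy flux. -/
lemma potential_eq {d : ℕ} {γ : ℝ} (hγ : 1 < γ) {v : State d} (hv : Admissible v) (j : Fin d) :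
    potential γ v j = dot (flux γ (consVars γ v) j) v
      - entropy γ (consVars γ v) * velocity (consVars γ v) j := by
  have hg : γ - 1 ≠ 0 := by linarith
  obtain ⟨hρ, hP⟩ := physical_consVars hγ hv
  conv_rhs => enter [1, 2]; rw [← entropyVars_consVars hγ hv]
  simp only [potential]
  set u := consVars γ v
  have hE : last u = pressure γ u / (γ - 1) + first u * speedSq u / 2 := by
    simp only [pressure]; field_simp; ring
  rw [flux, entropyVars, dot_mkState, entropy, hE]
  have hsum : ∑ i, (first u * velocity u j * velocity u i + if i = j then pressure γ u else 0) *
      (first u / pressure γ u * velocity u i)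
      = first u * velocity u j * (first u / pressure γ u) * speedSq u
        + first u * velocity u j := by
    simp only [add_mul, Finset.sum_add_distrib, ite_mul, zero_mul, Finset.sum_ite_eq',
      Finset.mem_univ, if_true, speedSq, Finset.mul_sum]
    congr 1
    · exact Finset.sum_congr rfl fun i _ => by ring
    · field_simp
  rw [hsum]
  field_simp; ring

/-! ### Conforming simplicial macro-element meshes of a periodic domain -/

/-- A conforming simplicial mesh of a periodic domain `ℝ^d / Λ`, grouped into macro-elements.
`ι` indexes the simplices and `κ` the macro-elements. The closed simplices, translated by the
period lattice `Λ`, tile `ℝ^d` with disjoint interiors, so their union is one period of the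
periodic domain. A facet is a pair `(K, i)`, the facet of `K` opposite to its `i`-th vertex.
The mesh is face-to-face: each facet coincides, up to a period (`0` for a facet in the interior of
the fundamental region), with exactly one other facet. -/
structure PeriodicMacroMesh (d : ℕ) [NeZero d] (ι κ : Type*) where
  /-- The simplices. -/
  elem : ι → Affine.Simplex ℝ (Space d) d
  /-- The macro-element to which a simplex belongs. -/
  macroOf : ι → κ
  /-- A basis of the lattice of periods. -/
  period : Module.Basis (Fin d) ℝ (Space d)
  covers : ∀ x : Space d, ∃ K, ∃ l ∈ Submodule.span ℤ (range period),
    x + l ∈ (elem K).closedInterior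
  interiors_disjoint : ∀ K K', ∀ l ∈ Submodule.span ℤ (range period), ∀ x,
    x ∈ (elem K).interior → x + l ∈ (elem K').interior → K = K' ∧ l = 0
  /-- The other facet with which a facet is identified. -/
  nbr : ι × Fin (d + 1) → ι × Fin (d + 1)
  /-- The period by which a facet has to be translated to coincide with `nbr` of it. -/
  shift : ι × Fin (d + 1) → Space d
  nbr_ne : ∀ f, nbr f ≠ f
  nbr_nbr : ∀ f, nbr (nbr f) = f
  shift_mem : ∀ f, shift f ∈ Submodule.span ℤ (range period)
  shift_nbr : ∀ f, shift (nbr f) = -shift f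
  facet_nbr : ∀ f, ((elem (nbr f).1).faceOpposite (nbr f).2).closedInterior =
    (fun x => x + shift f) '' ((elem f.1).faceOpposite f.2).closedInterior

namespace PeriodicMacroMesh

variable {d : ℕ} [NeZero d] {ι κ : Type*} (M : PeriodicMacroMesh d ι κ)

/-- The closed simplex `K`. -/
def cell (K : ι) : Set (Space d) := (M.elem K).closedInterior

/-- The closed region covered by a macro-element. -/
def region (m : κ) : Set (Space d) := ⋃ K ∈ {K | M.macroOf K = m}, M.cell K

/-- The closed facet. -/
def facet (f : ι × Fin (d + 1)) : Set (Space d) :=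
  ((M.elem f.1).faceOpposite f.2).closedInterior

/-- The `(d-1)`-dimensional surface measure on a facet. -/
def facetMeasure (f : ι × Fin (d + 1)) : Measure (Space d) :=
  (Measure.euclideanHausdorffMeasure (d - 1)).restrict (M.facet f)

/-- The unit normal of a facet `(K, i)` which is outward with respect to `K`: the normalized vector
from the `i`-th vertex to the foot of the altitude on the opposite facet. -/
def normal (f : ι × Fin (d + 1)) : Space d :=
  ((M.elem f.1).height f.2)⁻¹ • ((M.elem f.1).altitudeFoot f.2 - (M.elem f.1).points f.2)

/-- A facet is interior to a macro-element if it is shared, without a periodic translation, by two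
simplices of that macro-element. All other facets are on the interfaces between macro-elements,
i.e. they make up `∂𝒯_h`. -/
def IsInterface (f : ι × Fin (d + 1)) : Prop :=
  ¬(M.macroOf (M.nbr f).1 = M.macroOf f.1 ∧ M.shift f = 0)

open Classical in
/-- The facets in `∂𝒯_h`: each face on an interface between macro-elements is counted twice, once
from either side. -/
def interfaceFacets [Fintype ι] : Finset (ι × Fin (d + 1)) := {f | M.IsInterface f}

/-- `w : S → ℝ^(d+2)` has components in `𝒫_p(S)`, the polynomials of total degree at most `p`. -/
def IsPolyOn (p : ℕ) (S : Set (Space d)) (w : Space d → State d) : Prop :=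
  ∀ c, ∃ P : MvPolynomial (Fin d) ℝ, P.totalDegree ≤ p ∧
    ∀ x ∈ S, w x c = MvPolynomial.eval (fun j => x j) P

/-- The space `𝓥_h`: one function per macro-element, continuous on the macro-element and
polynomial of degree at most `p` on each of its simplices. No continuity is imposed between
different macro-elements. Values off the macro-element are irrelevant. -/
def MemV (p : ℕ) (w : κ → Space d → State d) : Prop :=
  (∀ m, ContinuousOn (w m) (M.region m)) ∧ ∀ K, IsPolyOn p (M.cell K) (w (M.macroOf K))

/-- The trace space `𝓜_h`: on the interfaces between macro-elements, a polynomial of degree at most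
`p` on each face, single-valued: identified facets, including those identified by periodicity, carry
the same values. Values off the face and on other facets are irrelevant. -/
def MemM [Fintype ι] (p : ℕ) (μ : ι × Fin (d + 1) → Space d → State d) : Prop :=
  ∀ f ∈ M.interfaceFacets, IsPolyOn p (M.facet f) (μ f) ∧
    ∀ x ∈ M.facet f, μ (M.nbr f) (x + M.shift f) = μ f x

end PeriodicMacroMesh

/-! ### The semi-discrete scheme -/

section Scheme

variable {d : ℕ} [NeZero d] {ι κ : Type*} [Fintype ι] (M : PeriodicMacroMesh d ι κ)

/-- `∂w_c / ∂x_j`. -/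
def partialDeriv (w : Space d → State d) (j : Fin d) (c : Fin (d + 2)) (x : Space d) : ℝ :=
  fderiv ℝ (fun y => w y c) x (EuclideanSpace.single j 1)

/-- `(v_h(t), v̂_h(t))`, `t ∈ [0,T]`, solves the macro-element entropy-variable HDG discretization
of the compressible Euler equations on the periodic domain, with inviscid numerical flux
`Fhat v̂ v n`. -/
structure IsSolution (p : ℕ) (γ : ℝ) (Fhat : State d → State d → Space d → State d) (T : ℝ)
    (v : ℝ → κ → Space d → State d) (vhat : ℝ → ι × Fin (d + 1) → Space d → State d) :
    Prop where
  memV : ∀ t ∈ Icc 0 T, M.MemV p (v t)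
  memM : ∀ t ∈ Icc 0 T, M.MemM p (vhat t)
  /-- The states are physical, so that `u(v_h)` and `u(v̂_h)` make sense. -/
  admissible : ∀ t ∈ Icc 0 T, ∀ K, ∀ x ∈ M.cell K, Admissible (v t (M.macroOf K) x)
  admissible_hat : ∀ t ∈ Icc 0 T, ∀ f ∈ M.interfaceFacets, ∀ x ∈ M.facet f,
    Admissible (vhat t f x)
  /-- `v_h` is differentiable in time. -/
  differentiable : ∀ K, ∀ x ∈ M.cell K,
    DifferentiableOn ℝ (fun t => v t (M.macroOf K) x) (Icc 0 T)
  /-- The face integrals of the numerical flux against test functions make sense. -/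
  flux_integrable : ∀ t ∈ Icc 0 T, ∀ f ∈ M.interfaceFacets,
    Integrable (fun x => Fhat (vhat t f x) (v t (M.macroOf f.1) x) (M.normal f))
      (M.facetMeasure f)
  /-- `(∂u(v_h)/∂t, w) - (F(v_h), ∇w) + ⟨F̂, w⟩ = 0` for all `w ∈ 𝓥_h`. -/
  balance : ∀ t ∈ Icc 0 T, ∀ w, M.MemV p w →
    (∑ K, ∫ x in M.cell K,
        dot (derivWithin (fun r => consVars γ (v r (M.macroOf K) x)) (Icc 0 T) t)
          (w (M.macroOf K) x))
    - (∑ K, ∫ x in M.cell K, ∑ j, ∑ c,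
        flux γ (consVars γ (v t (M.macroOf K) x)) j c * partialDeriv (w (M.macroOf K)) j c x)
    + (∑ f ∈ M.interfaceFacets, ∫ x,
        dot (Fhat (vhat t f x) (v t (M.macroOf f.1) x) (M.normal f)) (w (M.macroOf f.1) x)
          ∂(M.facetMeasure f)) = 0
  /-- `⟨F̂, μ⟩ = 0` for all `μ ∈ 𝓜_h` (there is no boundary on a periodic domain). -/
  transmission : ∀ t ∈ Icc 0 T, ∀ μ, M.MemM p μ →
    ∑ f ∈ M.interfaceFacets, ∫ x,
        dot (Fhat (vhat t f x) (v t (M.macroOf f.1) x) (M.normal f)) (μ f x)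
          ∂(M.facetMeasure f) = 0

/-- The quantity `[[v]]ᵀ F̂ - [[Ψ_n]]` for a trace state `v̂`, an element state `v` and an outward
unit normal `n`, where `[[a]] = â - a` and `Ψ_n = Ψ · n`. -/
def entropyResidual (γ : ℝ) (Fhat : State d → State d → Space d → State d)
    (vhat v : State d) (n : Space d) : ℝ :=
  dot (vhat - v) (Fhat vhat v n) - inner ℝ (potential γ vhat - potential γ v) n

/-- Total generalized entropy `∫_{𝒯_h} H(u(v_h))`. -/
def totalEntropy (γ : ℝ) (w : κ → Space d → State d) : ℝ :=
  ∑ K, ∫ x in M.cell K, entropy γ (consVars γ (w (M.macroOf K) x))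

/-- The total entropy is conserved on `[0,T]`. -/
def EntropyConservative (γ T : ℝ) (v : ℝ → κ → Space d → State d) : Prop :=
  (∀ t ∈ Icc 0 T, HasDerivWithinAt (fun r => totalEntropy M γ (v r)) 0 (Icc 0 T) t) ∧
  ∀ t ∈ Icc 0 T, totalEntropy M γ (v t) = totalEntropy M γ (v 0)

/-- The total entropy is differentiable with nonpositive derivative, and non-increasing,
on `[0,T]`. -/
def EntropyStable (γ T : ℝ) (v : ℝ → κ → Space d → State d) : Prop :=
  (∀ t ∈ Icc 0 T, ∃ r ≤ 0,
    HasDerivWithinAt (fun r => totalEntropy M γ (v r)) r (Icc 0 T) t) ∧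
  AntitoneOn (fun t => totalEntropy M γ (v t)) (Icc 0 T)

end Scheme

end EulerHDG

end

open EulerHDG

noncomputable section

namespace EulerHDG

/-! ### Calculus of the entropy variables: smoothness, `∂H/∂u = v` and `∂Ψ_j/∂v = F_j` -/

section States

variable {d : ℕ} {γ : ℝ}

/-! The unknown is the entropy variable itself, so `v_h` is an admissible test function. Since
`∂H/∂u = v` (`hasDerivWithinAt_entropy`), testing with `w = v_h` turns the time term into the
derivative of the total entropy. Since `∂Ψ_j/∂v = F_j` (`hasDerivWithinAt_potential`), the volume
term is the integral of `div Ψ(v_h)`. The divergence theorem on each simplex turns it into integrals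
of `Ψ_n` over facets, and those inside a macro-element cancel because both sides use the same
function and have opposite normals (`sum_facets_normal_flux`). Hence `d/dt ∫ H = ⟨Ψ_n(v_h), 1⟩ -
⟨F̂, v_h⟩` on the interfaces.

Two vanishing terms complete the jumps: `⟨F̂, v̂_h⟩ = 0` by the transmission condition with `μ =
v̂_h`, and `⟨Ψ_n(v̂_h), 1⟩ = 0` because `v̂_h` is single-valued and normals are opposite
(`sum_interface_normal_flux_eq_zero`). So the entropy rate is exactly the integral of `[[v]]ᵀ F̂ -
[[Ψ_n]]` over the interfaces (`IsSolution.hasDerivWithinAt_totalEntropy`), and both claims follow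
from its sign.

Three ingredients need real work. The divergence theorem on a simplex
(`setIntegral_directional_derivative`) comes from integrating in cones over the facets. Opposite
normals (`normal_nbr`) come from disjointness of interiors. Differentiation under the integral
(`hasDerivWithinAt_setIntegral_comp_poly`) assumes differentiability in time only pointwise in `x`;
polynomial interpolation makes it uniform. -/

lemma velocity_consVars {v : State d} (i : Fin d) :
    velocity (consVars γ v) i = middle v i / -last v := by
  simp only [velocity, consVars, first_mkState, middle_mkState]
  rw [mul_div_cancel_left₀ _ (Real.exp_pos _).ne']

lemma first_consVars (v : State d) :
    first (consVars γ v) = Real.exp (-(γ - (γ - 1) * (first v +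
      -last v * (∑ i, (middle v i / -last v) ^ 2) / 2) + Real.log (-last v)) / (γ - 1)) := rfl

lemma isOpen_admissible : IsOpen {v : State d | Admissible v} :=
  isOpen_lt (continuous_apply _) continuous_const

lemma contDiffAt_first_consVars {v : State d} (hv : Admissible v) :
    ContDiffAt ℝ 1 (fun v : State d => first (consVars γ v)) v := by
  have hβ : -last v ≠ 0 := by have : last v < 0 := hv; linarith
  have hl : ContDiffAt ℝ 1 (fun v : State d => last v) v := by unfold last; fun_prop
  have h0 : ContDiffAt ℝ 1 (fun v : State d => first v) v := by unfold first; fun_prop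
  have hm : ∀ i, ContDiffAt ℝ 1 (fun v : State d => middle v i) v := by
    intro i; unfold middle; fun_prop
  simp only [first_consVars]
  have hq : ContDiffAt ℝ 1 (fun v : State d => ∑ i, (middle v i / -last v) ^ 2) v :=
    ContDiffAt.sum fun i _ => ((hm i).div hl.neg hβ).pow 2
  exact (((contDiffAt_const.sub (contDiffAt_const.mul (h0.add
    ((hl.neg.mul hq).div_const 2)))).add (hl.neg.log hβ)).neg.div_const _).exp

lemma contDiffAt_velocity_consVars {v : State d} (hv : Admissible v) (i : Fin d) :
    ContDiffAt ℝ 1 (fun v : State d => velocity (consVars γ v) i) v := by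
  have hβ : -last v ≠ 0 := by have : last v < 0 := hv; linarith
  have hl : ContDiffAt ℝ 1 (fun v : State d => last v) v := by unfold last; fun_prop
  have hm : ContDiffAt ℝ 1 (fun v : State d => middle v i) v := by unfold middle; fun_prop
  simp only [velocity_consVars]
  exact hm.div hl.neg hβ

lemma contDiffAt_potential {v : State d} (hv : Admissible v) (j : Fin d) :
    ContDiffAt ℝ 1 (fun v : State d => potential γ v j) v :=
  (contDiffAt_first_consVars hv).mul (contDiffAt_velocity_consVars hv j)

lemma last_eq_pressure (hγ : 1 < γ) (u : State d) :
    last u = pressure γ u / (γ - 1) + first u * speedSq u / 2 := by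
  have hg : γ - 1 ≠ 0 := by linarith
  simp only [pressure]; field_simp; ring

lemma contDiffAt_speedSq_consVars {v : State d} (hv : Admissible v) :
    ContDiffAt ℝ 1 (fun v : State d => speedSq (consVars γ v)) v := 
  ContDiffAt.sum fun i _ => (contDiffAt_velocity_consVars hv i).pow 2

lemma contDiffAt_consVars (hγ : 1 < γ) {v : State d} (hv : Admissible v) :
    ContDiffAt ℝ 1 (fun v : State d => consVars γ v) v := by
  have hβ : -last v ≠ 0 := by have : last v < 0 := hv; linarith
  have hl : ContDiffAt ℝ 1 (fun v : State d => last v) v := by unfold last; fun_prop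
  have hρ := contDiffAt_first_consVars (γ := γ) hv
  have hV := contDiffAt_velocity_consVars (γ := γ) hv
  -- All components are expressed through `ρ`, `V` and `β`, already known to be smooth; the energy
  -- uses `P = ρ / β`.
  have key : ∀ v : State d, consVars γ v = mkState (first (consVars γ v))
      (fun i => first (consVars γ v) * velocity (consVars γ v) i)
      (first (consVars γ v) / -last v / (γ - 1) +
        first (consVars γ v) * speedSq (consVars γ v) / 2) := by
    intro v
    rw [← pressure_consVars hγ, ← last_eq_pressure hγ]
    conv_lhs => rw [← mkState_components (consVars γ v)]
    congr 1
    funext i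
    have : first (consVars γ v) ≠ 0 := (Real.exp_pos _).ne'
    rw [velocity, mul_div_cancel₀ _ this]
  rw [contDiffAt_pi]
  intro c
  have hc : (fun v : State d => consVars γ v c) = fun v => mkState (first (consVars γ v))
      (fun i => first (consVars γ v) * velocity (consVars γ v) i)
      (first (consVars γ v) / -last v / (γ - 1) +
        first (consVars γ v) * speedSq (consVars γ v) / 2) c := by
    funext v; rw [← key]
  rw [hc]
  refine Fin.cases hρ (fun j => ?_) c
  refine Fin.lastCases ?_ (fun i => ?_) j
  · simp only [mkState, Fin.cons_succ, Fin.snoc_last]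
    exact ((hρ.div hl.neg hβ).div_const _).add
      ((hρ.mul (contDiffAt_speedSq_consVars hv)).div_const _)
  · simp only [mkState, Fin.cons_succ, Fin.snoc_castSucc]
    exact hρ.mul (hV i)

lemma specificEntropy_eq {u : State d} (hu : Physical γ u) :
    specificEntropy γ u = Real.log (pressure γ u) - γ * Real.log (first u) := by
  rw [specificEntropy, Real.log_div hu.2.ne' (Real.rpow_pos_of_pos hu.1 γ).ne',
      Real.log_rpow hu.1]

/-- Follows from `P = ρ / β`. It makes the entropy visibly smooth in `v`, with no real powers left.
-/
lemma specificEntropy_consVars (hγ : 1 < γ) {v : State d} (hv : Admissible v) :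
    specificEntropy γ (consVars γ v) =
      (1 - γ) * Real.log (first (consVars γ v)) - Real.log (-last v) := by
  have hβ : 0 < -last v := by simpa [Admissible] using hv
  have hu := physical_consVars hγ hv
  rw [specificEntropy_eq hu, pressure_consVars hγ, Real.log_div hu.1.ne' hβ.ne']
  ring

lemma contDiffAt_entropy_consVars (hγ : 1 < γ) {v : State d} (hv : Admissible v) :
    ContDiffAt ℝ 1 (fun v : State d => entropy γ (consVars γ v)) v := by
  have hβ : -last v ≠ 0 := by have : last v < 0 := hv; linarith
  have hl : ContDiffAt ℝ 1 (fun v : State d => last v) v := by unfold last; fun_prop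
  have hρ := contDiffAt_first_consVars (γ := γ) hv
  have h : ContDiffAt ℝ 1 (fun v : State d => -(first (consVars γ v) *
      ((1 - γ) * Real.log (first (consVars γ v)) - Real.log (-last v))) / (γ - 1)) v :=
    (hρ.mul ((contDiffAt_const.mul (hρ.log (physical_consVars hγ hv).1.ne')).sub
      (hl.neg.log hβ))).neg.div_const _
  -- The formula for `s` holds only at admissible states, which form an open set.
  refine h.congr_of_eventuallyEq ?_
  filter_upwards [isOpen_admissible.mem_nhds hv] with w hw
  rw [entropy, specificEntropy_consVars hγ hw]

/-- `∂H/∂u = v`. -/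
lemma hasDerivWithinAt_entropy (hγ : 1 < γ) {u : ℝ → State d} {u' : State d} {S : Set ℝ} {t : ℝ}
    (hu : HasDerivWithinAt u u' S t) (hphys : ∀ r ∈ S, Physical γ (u r)) (ht : t ∈ S) :
    HasDerivWithinAt (fun r => entropy γ (u r)) (dot u' (entropyVars γ (u t))) S t := by
  have hg : γ - 1 ≠ 0 := by linarith
  obtain ⟨hρ0, hP0⟩ := hphys t ht
  rw [hasDerivWithinAt_pi] at hu
  have hρ : HasDerivWithinAt (fun r => first (u r)) (first u') S t := hu 0
  have hm : ∀ i, HasDerivWithinAt (fun r => middle (u r) i) (middle u' i) S t := fun i => hu _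
  have hE : HasDerivWithinAt (fun r => last (u r)) (last u') S t := hu _
  have hV : ∀ i, HasDerivWithinAt (fun r => velocity (u r) i)
      ((middle u' i - velocity (u t) i * first u') / first (u t)) S t := by
    intro i
    refine ((hm i).div hρ hρ0.ne').congr_deriv ?_
    simp only [velocity]; field_simp
  have hq : HasDerivWithinAt (fun r => speedSq (u r))
      (∑ i, 2 * velocity (u t) i * ((middle u' i - velocity (u t) i * first u') / first (u t)))
      S t := by
    refine (HasDerivWithinAt.fun_sum fun i _ => (hV i).pow 2).congr_deriv ?_
    simp
  -- The kinetic energy `ρ|V|²/2` has derivative `V · (ρV)' - ρ'|V|²/2`.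
  have hP : HasDerivWithinAt (fun r => pressure γ (u r))
      ((γ - 1) * (last u' + first u' * speedSq (u t) / 2
        - ∑ i, velocity (u t) i * middle u' i)) S t := by
    refine ((hE.sub ((hρ.mul hq).div_const 2)).const_mul (γ - 1)).congr_deriv ?_
    congr 1
    have : first (u t) * ∑ i, 2 * velocity (u t) i *
        ((middle u' i - velocity (u t) i * first u') / first (u t)) =
        2 * (∑ i, velocity (u t) i * middle u' i) - 2 * first u' * speedSq (u t) := by
      simp only [speedSq, Finset.mul_sum, ← Finset.sum_sub_distrib]
      refine Finset.sum_congr rfl fun i _ => ?_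
      field_simp
    rw [this]; ring
  -- `H` is differentiated in the form `-ρ (log P - γ log ρ) / (γ - 1)`, which agrees with it along
  -- the curve because all states there are physical.
  have hs := ((hρ.mul ((hP.log hP0.ne').sub ((hρ.log hρ0.ne').const_mul γ))).neg.div_const (γ - 1))
  refine (hs.congr_deriv ?_).congr (fun r hr => ?_) ?_
  · conv_rhs => rw [← mkState_components u']
    rw [entropyVars, dot_mkState, specificEntropy_eq (hphys t ht)]
    have : ∑ i, middle u' i * (first (u t) / pressure γ (u t) * velocity (u t) i) =
        first (u t) / pressure γ (u t) * ∑ i, velocity (u t) i * middle u' i := by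
      rw [Finset.mul_sum]; exact Finset.sum_congr rfl fun i _ => by ring
    rw [this]
    simp only [Pi.sub_apply]
    field_simp
    ring
  · simp [entropy, specificEntropy_eq (hphys r hr)]
  · simp [entropy, specificEntropy_eq (hphys t ht)]

/-- `∂Ψ_j/∂v = F_j`. -/
lemma hasDerivWithinAt_potential (hγ : 1 < γ) {v : ℝ → State d} {v' : State d} {S : Set ℝ} {t : ℝ}
    (hv : HasDerivWithinAt v v' S t) (hadm : Admissible (v t)) (j : Fin d) :
    HasDerivWithinAt (fun r => potential γ (v r) j) (dot (flux γ (consVars γ (v t)) j) v') S t := by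
  have hg : γ - 1 ≠ 0 := by linarith
  have hl : last (v t) < 0 := hadm
  have hβ : -last (v t) ≠ 0 := by linarith
  have hl0 : last (v t) ≠ 0 := hl.ne
  rw [hasDerivWithinAt_pi] at hv
  have h0 : HasDerivWithinAt (fun r => first (v r)) (first v') S t := hv 0
  have hm : ∀ i, HasDerivWithinAt (fun r => middle (v r) i) (middle v' i) S t := fun i => hv _
  have hL : HasDerivWithinAt (fun r => -last (v r)) (-last v') S t := (hv _).neg
  set u := consVars γ (v t) with hu
  have hV : ∀ i, HasDerivWithinAt (fun r => velocity (consVars γ (v r)) i)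
      ((middle v' i + velocity u i * last v') / -last (v t)) S t := by
    intro i
    simp only [hu, velocity_consVars]
    refine ((hm i).div hL hβ).congr_deriv ?_
    field_simp
    ring
  have hq : HasDerivWithinAt (fun r => speedSq (consVars γ (v r)))
      (∑ i, 2 * velocity u i * ((middle v' i + velocity u i * last v') / -last (v t))) S t := by
    refine (HasDerivWithinAt.fun_sum fun i _ => (hV i).pow 2).congr_deriv ?_
    simp [hu]
  have hρ : HasDerivWithinAt (fun r => first (consVars γ (v r)))
      (first u * (first v' + ∑ i, velocity u i * middle v' i + last v' * speedSq u / 2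
        + last v' / (-last (v t) * (γ - 1)))) S t := by
    -- As `ρ` is an exponential, its derivative is `ρ` times the derivative of the exponent.
    have hexp : ∀ w : State d, first (consVars γ w) = Real.exp (-(γ - (γ - 1) * (first w +
      -last w * speedSq (consVars γ w) / 2) + Real.log (-last w)) / (γ - 1)) := by
      intro w; simp only [speedSq, velocity_consVars]; exact first_consVars w
    have h := (((((h0.add ((hL.mul hq).div_const 2)).const_mul (γ - 1)).const_sub γ).add
      (hL.log hβ)).neg.div_const (γ - 1)).exp
    refine (h.congr_deriv ?_).congr (fun r _ => hexp _) (hexp _)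
    simp only [Pi.add_apply, Pi.mul_apply, Pi.neg_apply]
    rw [← hu, hu, ← hexp, ← hu]
    congr 1
    have : (-last (v t)) * ∑ i, 2 * velocity u i *
        ((middle v' i + velocity u i * last v') / -last (v t)) =
        2 * (∑ i, velocity u i * middle v' i) + 2 * last v' * speedSq u := by
      simp only [speedSq, Finset.mul_sum, ← Finset.sum_add_distrib]
      refine Finset.sum_congr rfl fun i _ => ?_
      field_simp
    rw [this]
    field_simp
    ring
  refine (hρ.mul (hV j)).congr_deriv ?_
  conv_rhs => rw [← mkState_components v']
  rw [flux, dot_mkState]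
  have hsum : ∑ i, (first u * velocity u j * velocity u i + if i = j then pressure γ u else 0) *
      middle v' i = first u * velocity u j * (∑ i, velocity u i * middle v' i)
        + pressure γ u * middle v' j := by
    simp only [add_mul, Finset.sum_add_distrib, ite_mul, zero_mul, Finset.sum_ite_eq',
      Finset.mem_univ, if_true, Finset.mul_sum]
    congr 1
    exact Finset.sum_congr rfl fun i _ => by ring
  -- The product rule for `ρ V_j` matches the flux once `P = ρ / β` is inserted.
  rw [hsum, last_eq_pressure hγ u, hu, pressure_consVars hγ, ← hu]
  field_simp
  ring

end States

/-! ### Orthogonal coordinates adapted to a unit normal -/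

section Coordinates

variable {d : ℕ}

/-- Coordinates along and orthogonal to the normal preserve volume. -/
lemma measurePreserving_normalCoords {n : Space d} (hn : ‖n‖ = 1) (p : Space d) :
    MeasurePreserving (fun q : ℝ × (ℝ ∙ n)ᗮ => p + (q.1 • n + q.2)) := by
  have h1 := ((LinearIsometryEquiv.toSpanUnitSingleton (𝕜 := ℝ) n hn).measurePreserving).prod
    (MeasurePreserving.id (volume : Measure (ℝ ∙ n)ᗮ))
  have h2 := ((ℝ ∙ n).measurePreserving_measurableEquivProd p).symm
  rw [InnerProductSpace.euclideanHausdorffMeasure_eq_volume] at h2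
  convert! h2.comp h1 using 1
  ext q : 1
  simp [Submodule.measurableEquivProd_symm_apply, add_comm]

lemma measurableEmbedding_normalCoords {n : Space d} (hn : ‖n‖ = 1) (p : Space d) :
    MeasurableEmbedding (fun q : ℝ × (ℝ ∙ n)ᗮ => p + (q.1 • n + q.2)) := by
  have h1 : MeasurableEmbedding fun q : ℝ × (ℝ ∙ n)ᗮ =>
      ((LinearIsometryEquiv.toSpanUnitSingleton (𝕜 := ℝ) n hn) q.1, q.2) :=
    ((LinearIsometryEquiv.toSpanUnitSingleton (𝕜 := ℝ) n hn).toHomeomorph.prodCongr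
      (Homeomorph.refl _)).measurableEmbedding
  have h2 := ((ℝ ∙ n).measurableEquivProd p).symm.measurableEmbedding
  convert! h2.comp h1 using 1
  ext q : 1
  simp [Submodule.measurableEquivProd_symm_apply, add_comm]

/-- A linear identity on `ℝ^d` can therefore be checked on the edges at one vertex. -/
lemma span_range_edges (s : Affine.Simplex ℝ (Space d) d) :
    Submodule.span ℝ (range fun i => s.points i - s.points 0) = ⊤ := by
  have h : affineSpan ℝ (range s.points) = ⊤ := by
    rw [s.independent.affineSpan_eq_top_iff_card_eq_finrank_add_one]
    simp
  have h2 := congrArg AffineSubspace.direction h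
  rw [AffineSubspace.direction_top, direction_affineSpan,
    vectorSpan_range_eq_span_range_vsub_right ℝ _ (0 : Fin (d + 1))] at h2
  exact h2

end Coordinates

/-! ### The divergence theorem on a simplex -/

section Simplex

variable {d : ℕ} [NeZero d] (s : Affine.Simplex ℝ (Space d) d) (i : Fin (d + 1))

/-- The unit normal of the facet opposite to vertex `i`, outward with respect to the simplex. -/
def facetNormal : Space d := (s.height i)⁻¹ • (s.altitudeFoot i - s.points i)

lemma height_smul_facetNormal :
    s.height i • facetNormal s i = s.altitudeFoot i - s.points i := by
  rw [facetNormal, smul_inv_smul₀ (s.height_pos i).ne']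

lemma norm_facetNormal : ‖facetNormal s i‖ = 1 := by
  have h := s.height_pos i
  rw [facetNormal, norm_smul, norm_inv, Real.norm_of_nonneg h.le, ← dist_eq_norm, dist_comm]
  exact inv_mul_cancel₀ h.ne'

lemma inner_facetNormal_eq_zero {v : Space d}
    (hv : v ∈ (affineSpan ℝ (range (s.faceOpposite i).points)).direction) :
    inner ℝ v (facetNormal s i) = 0 := by
  have h := EuclideanGeometry.vsub_orthogonalProjection_mem_direction_orthogonal
    (affineSpan ℝ (range (s.faceOpposite i).points)) (s.points i)
  have h2 : inner ℝ v (s.points i - s.altitudeFoot i) = 0 :=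
    Submodule.inner_right_of_mem_orthogonal hv h
  rw [facetNormal, inner_smul_right, ← neg_sub, inner_neg_right, h2]
  simp

lemma inner_sub_point_facetNormal {y : Space d}
    (hy : y ∈ affineSpan ℝ (range (s.faceOpposite i).points)) :
    inner ℝ (y - s.points i) (facetNormal s i) = s.height i := by
  have h1 : inner ℝ (y - s.altitudeFoot i) (facetNormal s i) = 0 :=
    inner_facetNormal_eq_zero s i
      (AffineSubspace.vsub_mem_direction hy (s.altitudeFoot_mem_affineSpan_faceOpposite i))
  rw [← sub_add_sub_cancel y (s.altitudeFoot i), inner_add_left, h1,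
    ← height_smul_facetNormal, inner_smul_left, real_inner_self_eq_norm_sq, norm_facetNormal]
  simp

/-- A simplex is the convex join of a vertex and the opposite facet; this is the source of the
conical coordinates. -/
lemma mem_closedInterior_iff_exists_faceOpposite {x : Space d} :
    x ∈ s.closedInterior ↔ ∃ y ∈ (s.faceOpposite i).closedInterior, ∃ θ ∈ Icc (0 : ℝ) 1,
      s.points i + θ • (y - s.points i) = x := by
  have hr : range s.points = insert (s.points i) (range (s.faceOpposite i).points) := by
    rw [s.range_faceOpposite_points, ← image_insert_eq, ← image_univ]
    congr 1
    ext j; simp [em]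
  rw [← Affine.Simplex.convexHull_eq_closedInterior, hr, convexHull_insert (range_nonempty _),
    Affine.Simplex.convexHull_eq_closedInterior, mem_convexJoin]
  simp [segment_eq_image']

/-- Points of the hyperplane of a facet, in coordinates orthogonal to the normal. -/
def facetChart (w : (ℝ ∙ facetNormal s i)ᗮ) : Space d := s.altitudeFoot i + w

lemma facetNormal_ne_zero : facetNormal s i ≠ 0 := by
  rw [← norm_ne_zero_iff, norm_facetNormal]; exact one_ne_zero

lemma finrank_facetNormal_orthogonal :
    Module.finrank ℝ (ℝ ∙ facetNormal s i)ᗮ = d - 1 := by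
  have : Fact (Module.finrank ℝ (Space d) = d - 1 + 1) :=
    ⟨by rw [finrank_euclideanSpace_fin, Nat.sub_add_cancel (NeZero.one_le)]⟩
  exact Submodule.finrank_orthogonal_span_singleton (facetNormal_ne_zero s i)

lemma isometry_facetChart : Isometry (facetChart s i) :=
  (IsometryEquiv.addLeft (s.altitudeFoot i)).isometry.comp isometry_subtype_coe

lemma measurableEmbedding_facetChart : MeasurableEmbedding (facetChart s i) :=
  (isometry_facetChart s i).isClosedEmbedding.measurableEmbedding

lemma closedInterior_faceOpposite_subset_range :
    (s.faceOpposite i).closedInterior ⊆ range (facetChart s i) := by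
  intro y hy
  have hy' := Affine.Simplex.closedInterior_subset_affineSpan hy
  refine ⟨⟨y - s.altitudeFoot i, ?_⟩, by simp [facetChart]⟩
  rw [Submodule.mem_orthogonal_singleton_iff_inner_left]
  exact inner_facetNormal_eq_zero s i
    (AffineSubspace.vsub_mem_direction hy' (s.altitudeFoot_mem_affineSpan_faceOpposite i))

/-- The facet in the coordinates of `facetChart`. -/
def facetPreimage : Set (ℝ ∙ facetNormal s i)ᗮ :=
  facetChart s i ⁻¹' (s.faceOpposite i).closedInterior

lemma isCompact_facetPreimage : IsCompact (facetPreimage s i) :=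
  (isometry_facetChart s i).isClosedEmbedding.isCompact_preimage
    (s.faceOpposite i).isCompact_closedInterior

lemma map_facetChart_volume :
    (volume : Measure (ℝ ∙ facetNormal s i)ᗮ).map (facetChart s i) =
      (Measure.euclideanHausdorffMeasure (d - 1)).restrict (range (facetChart s i)) := by
  rw [← (isometry_facetChart s i).map_euclideanHausdorffMeasure,
    ← finrank_facetNormal_orthogonal s i, InnerProductSpace.euclideanHausdorffMeasure_eq_volume]

/-- The chart is an isometry from a space of dimension `d - 1`, so surface measure becomes Lebesgue
measure and Fubini applies to facets. -/
lemma restrict_facet_eq_map :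
    (Measure.euclideanHausdorffMeasure (d - 1)).restrict (s.faceOpposite i).closedInterior =
      ((volume : Measure (ℝ ∙ facetNormal s i)ᗮ).restrict (facetPreimage s i)).map
        (facetChart s i) := by
  rw [facetPreimage, ← (measurableEmbedding_facetChart s i).restrict_map, map_facetChart_volume,
    Measure.restrict_restrict_of_subset (closedInterior_faceOpposite_subset_range s i)]

lemma setIntegral_facet (f : Space d → ℝ) :
    ∫ x in (s.faceOpposite i).closedInterior, f x ∂(Measure.euclideanHausdorffMeasure (d - 1)) =
      ∫ w in facetPreimage s i, f (facetChart s i w) := by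
  rw [restrict_facet_eq_map, (measurableEmbedding_facetChart s i).integral_map]

lemma isFiniteMeasure_restrict_facet : IsFiniteMeasure
    ((Measure.euclideanHausdorffMeasure (d - 1)).restrict
      (s.faceOpposite i).closedInterior : Measure (Space d)) := by
  rw [restrict_facet_eq_map]
  have : IsFiniteMeasure
      ((volume : Measure (ℝ ∙ facetNormal s i)ᗮ).restrict (facetPreimage s i)) :=
    ⟨by simpa using (isCompact_facetPreimage s i).measure_lt_top⟩
  infer_instance

lemma point_add_mem_closedInterior_iff {r : ℝ} (hr : 0 < r) (w : (ℝ ∙ facetNormal s i)ᗮ) :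
    s.points i + r • (facetChart s i w - s.points i) ∈ s.closedInterior ↔
      r ≤ 1 ∧ w ∈ facetPreimage s i := by
  rw [mem_closedInterior_iff_exists_faceOpposite s i]
  constructor
  · rintro ⟨y, hy, θ, hθ, h⟩
    have h := add_left_cancel h
    -- All points of the facet's hyperplane have normal coordinate `height` relative to the vertex,
    -- so this pairing forces `θ = r`; then `r > 0` can be cancelled.
    have h2 := congrArg (fun z => inner ℝ z (facetNormal s i)) h
    have hw : inner ℝ (facetChart s i w - s.points i) (facetNormal s i) = s.height i := by
      have hw0 : inner ℝ (w : Space d) (facetNormal s i) = 0 :=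
        (Submodule.mem_orthogonal_singleton_iff_inner_left).1 w.2
      rw [facetChart, add_sub_right_comm, inner_add_left, hw0, add_zero]
      exact inner_sub_point_facetNormal s i (s.altitudeFoot_mem_affineSpan_faceOpposite i)
    simp only [inner_smul_left, hw, inner_sub_point_facetNormal s i
      (Affine.Simplex.closedInterior_subset_affineSpan hy)] at h2
    have h3 : θ = r := by simpa using mul_right_cancel₀ (s.height_pos i).ne' h2
    subst h3
    have h4 := sub_left_inj.1 (smul_right_injective _ hr.ne' h)
    exact ⟨hθ.2, by rw [facetPreimage, mem_preimage, ← h4]; exact hy⟩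
  · rintro ⟨h1, h2⟩
    exact ⟨_, h2, r, ⟨hr.le, h1⟩, rfl⟩

lemma facetNormal_coord_nonneg {r : ℝ} (w : (ℝ ∙ facetNormal s i)ᗮ)
    (h : s.points i + (r • facetNormal s i + (w : Space d)) ∈ s.closedInterior) : 0 ≤ r := by
  obtain ⟨y, hy, θ, hθ, h⟩ := (mem_closedInterior_iff_exists_faceOpposite s i).1 h
  have h2 := congrArg (fun z => inner ℝ z (facetNormal s i)) (add_left_cancel h)
  have hw0 : inner ℝ (w : Space d) (facetNormal s i) = 0 :=
    (Submodule.mem_orthogonal_singleton_iff_inner_left).1 w.2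
  simp only [inner_smul_left, inner_add_left, hw0, inner_sub_point_facetNormal s i
    (Affine.Simplex.closedInterior_subset_affineSpan hy), real_inner_self_eq_norm_sq,
    norm_facetNormal] at h2
  have : θ * s.height i = r := by simpa using h2
  rw [← this]
  exact mul_nonneg hθ.1 (s.height_pos i).le

/-- Integration over a simplex in conical coordinates centred at the `i`-th vertex. -/
lemma setIntegral_closedInterior_eq_cone {g : Space d → ℝ}
    (hg : ContinuousOn g s.closedInterior) :
    ∫ x in s.closedInterior, g x = s.height i * ∫ r in Ioc (0 : ℝ) 1, ∫ w in facetPreimage s i,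
      r ^ (d - 1) * g (s.points i + r • (facetChart s i w - s.points i)) := by
  set n := facetNormal s i
  set p := s.points i
  have hn : ‖n‖ = 1 := norm_facetNormal s i
  have hh := s.height_pos i
  have hmeas : MeasurableSet s.closedInterior := s.isClosed_closedInterior.measurableSet
  have hint : Integrable (s.closedInterior.indicator g) :=
    (hg.integrableOn_compact s.isCompact_closedInterior).integrable_indicator hmeas
  have hmp := measurePreserving_normalCoords hn p
  have hme := measurableEmbedding_normalCoords hn p
  rw [← integral_indicator hmeas, ← hmp.integral_comp hme, Measure.volume_eq_prod, integral_prod]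
  swap
  · exact (hmp.integrable_comp_emb hme).2 hint
  set G : ℝ → ℝ := fun r => ∫ w : (ℝ ∙ n)ᗮ,
    s.closedInterior.indicator g (p + (r • n + (w : Space d))) with hG
  -- The normal coordinate is measured in units of the height, so the simplex occupies `0 ≤ r ≤ 1`.
  have hscale : ∫ r, G r = s.height i * ∫ r, G (s.height i * r) := by
    rw [Measure.integral_comp_mul_left, abs_of_pos (inv_pos.2 hh), smul_eq_mul,
      mul_inv_cancel_left₀ hh.ne']
  rw [hscale, ← integral_indicator measurableSet_Ioc]
  congr 1
  refine integral_congr_ae ?_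
  filter_upwards [Measure.ae_ne volume (0 : ℝ)] with r hr0
  rcases lt_or_gt_of_ne hr0 with hr | hr
  · have h0 : ∀ w : (ℝ ∙ n)ᗮ,
        s.closedInterior.indicator g (p + ((s.height i * r) • n + (w : Space d))) = 0 := by
      intro w
      refine indicator_of_notMem (fun h => ?_) _
      have := facetNormal_coord_nonneg s i w h
      nlinarith
    rw [indicator_of_notMem (by simp [hr.le]), hG]
    simp [h0]
  · have hpt : ∀ w : (ℝ ∙ n)ᗮ, p + ((s.height i * r) • n + ((r • w : (ℝ ∙ n)ᗮ) : Space d)) =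
        p + r • (facetChart s i w - p) := by
      intro w
      rw [facetChart, add_sub_right_comm, ← height_smul_facetNormal, smul_add, smul_smul,
        mul_comm r]
      rfl
    -- The slice at level `r` is the facet scaled by `r` in `d - 1` dimensions, which gives the
    -- Jacobian `r ^ (d - 1)`.
    have hsm : G (s.height i * r) = r ^ (d - 1) * ∫ w : (ℝ ∙ n)ᗮ,
        s.closedInterior.indicator g (p + r • (facetChart s i w - p)) := by
      have := Measure.integral_comp_smul (volume : Measure (ℝ ∙ n)ᗮ)
        (fun w => s.closedInterior.indicator g (p + ((s.height i * r) • n + (w : Space d)))) r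
      simp only [hpt] at this
      rw [this, finrank_facetNormal_orthogonal, abs_of_pos (by positivity), smul_eq_mul,
        mul_inv_cancel_left₀ (by positivity)]
    rw [hsm]
    by_cases hr1 : r ≤ 1
    · rw [indicator_of_mem (show r ∈ Ioc (0 : ℝ) 1 from ⟨hr, hr1⟩), integral_const_mul, ← integral_indicator
        (isCompact_facetPreimage s i).isClosed.measurableSet]
      congr 2
      ext w
      by_cases hw : w ∈ facetPreimage s i
      · rw [indicator_of_mem hw, indicator_of_mem
          ((point_add_mem_closedInterior_iff s i hr w).2 ⟨hr1, hw⟩)]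
      · rw [indicator_of_notMem hw, indicator_of_notMem
          (fun h => hw ((point_add_mem_closedInterior_iff s i hr w).1 h).2)]
    · rw [indicator_of_notMem (fun h => hr1 h.2)]
      have h0 : ∀ w : (ℝ ∙ n)ᗮ,
          s.closedInterior.indicator g (p + r • (facetChart s i w - p)) = 0 := fun w =>
        indicator_of_notMem
          (fun h => hr1 ((point_add_mem_closedInterior_iff s i hr w).1 h).1) _
      simp [h0]

/-- The divergence theorem on a simplex for the radial fields `f (x - p_i)`, which are tangential
on all facets except the one opposite to `p_i`. -/
lemma setIntegral_radial_divergence {f : Space d → ℝ} {f' : Space d → Space d →L[ℝ] ℝ}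
    (hf : ∀ x ∈ s.closedInterior, HasFDerivAt f (f' x) x)
    (hf' : ContinuousOn f' s.closedInterior) :
    ∫ x in s.closedInterior, (d * f x + f' x (x - s.points i)) =
      s.height i * ∫ x in (s.faceOpposite i).closedInterior, f x
        ∂(Measure.euclideanHausdorffMeasure (d - 1)) := by
  set p := s.points i
  have hfc : ContinuousOn f s.closedInterior := fun x hx => (hf x hx).continuousAt.continuousWithinAt
  have hg : ContinuousOn (fun x => d * f x + f' x (x - p)) s.closedInterior :=
    (continuousOn_const.mul hfc).add (hf'.clm_apply (by fun_prop))
  have hd : d - 1 + 1 = d := Nat.sub_add_cancel NeZero.one_le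
  have hmem : ∀ q ∈ Icc (0 : ℝ) 1 ×ˢ facetPreimage s i,
      p + q.1 • (facetChart s i q.2 - p) ∈ s.closedInterior := fun q hq =>
    (mem_closedInterior_iff_exists_faceOpposite s i).2 ⟨_, hq.2, q.1, hq.1, rfl⟩
  have hcont : ContinuousOn (fun q : ℝ × (ℝ ∙ facetNormal s i)ᗮ => q.1 ^ (d - 1) *
      (d * f (p + q.1 • (facetChart s i q.2 - p)) +
        f' (p + q.1 • (facetChart s i q.2 - p)) (p + q.1 • (facetChart s i q.2 - p) - p)))
      (Icc 0 1 ×ˢ facetPreimage s i) := by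
    have hch : Continuous (facetChart s i) := (isometry_facetChart s i).continuous
    have hmap : ContinuousOn (fun q : ℝ × (ℝ ∙ facetNormal s i)ᗮ =>
        p + q.1 • (facetChart s i q.2 - p)) (Icc 0 1 ×ˢ facetPreimage s i) := by fun_prop
    exact ContinuousOn.mul (by fun_prop) (hg.comp hmap hmem)
  -- With the radial integral innermost, the integrand on the ray to a facet point `y` is the
  -- derivative of `r ^ d * f (p + r • (y - p))`.
  rw [setIntegral_closedInterior_eq_cone s i hg, setIntegral_facet, integral_integral_swap]
  swap
  · rw [Measure.prod_restrict]
    exact (hcont.integrableOn_compact (isCompact_Icc.prod (isCompact_facetPreimage s i))).mono_set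
      (prod_mono_left Ioc_subset_Icc_self)
  congr 1
  refine setIntegral_congr_fun (isCompact_facetPreimage s i).isClosed.measurableSet fun w hw => ?_
  rw [← intervalIntegral.integral_of_le zero_le_one,
    intervalIntegral.integral_eq_sub_of_hasDerivAt
      (f := fun r : ℝ => r ^ d * f (p + r • (facetChart s i w - p)))]
  -- The contribution at the vertex, `r = 0`, vanishes because `d ≥ 1`.
  · simp [NeZero.ne d]
  · intro r hr
    rw [uIcc_of_le zero_le_one] at hr
    have h1 : HasDerivAt (fun r : ℝ => p + r • (facetChart s i w - p)) (facetChart s i w - p) r := by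
      simpa using ((hasDerivAt_id r).smul_const (facetChart s i w - p)).const_add p
    have h2 := (hf _ (hmem (r, w) ⟨hr, hw⟩)).comp_hasDerivAt r h1
    refine ((hasDerivAt_pow d r).mul h2).congr_deriv ?_
    have hpow : r ^ d = r ^ (d - 1) * r := by rw [← pow_succ, hd]
    change _ = r ^ (d - 1) * (d * f (p + r • (facetChart s i w - p)) +
      f' (p + r • (facetChart s i w - p)) (p + r • (facetChart s i w - p) - p))
    simp only [add_sub_cancel_left, map_smul, smul_eq_mul, Function.comp_apply, hpow]
    ring
  · refine ContinuousOn.intervalIntegrable ?_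
    rw [uIcc_of_le zero_le_one]
    exact hcont.comp (f := fun r : ℝ => (r, w)) (by fun_prop) fun r hr => ⟨hr, hw⟩

lemma inner_edge_facetNormal {i j : Fin (d + 1)} (h : j ≠ i) :
    inner ℝ (s.points j - s.points i) (facetNormal s i) = s.height i := by
  refine inner_sub_point_facetNormal s i (subset_affineSpan ℝ _ ?_)
  rw [s.range_faceOpposite_points]
  exact ⟨j, h, rfl⟩

/-- The divergence theorem on a simplex. -/
theorem setIntegral_directional_derivative {f : Space d → ℝ} {f' : Space d → Space d →L[ℝ] ℝ}
    (hf : ∀ x ∈ s.closedInterior, HasFDerivAt f (f' x) x)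
    (hf' : ContinuousOn f' s.closedInterior) (e : Space d) :
    ∫ x in s.closedInterior, f' x e = ∑ i, inner ℝ e (facetNormal s i) *
      ∫ x in (s.faceOpposite i).closedInterior, f x
        ∂(Measure.euclideanHausdorffMeasure (d - 1)) := by
  have hfc : ContinuousOn f s.closedInterior := fun x hx => (hf x hx).continuousAt.continuousWithinAt
  have hint : ∀ e, IntegrableOn (fun x => f' x e) s.closedInterior := fun e =>
    (hf'.clm_apply continuousOn_const).integrableOn_compact s.isCompact_closedInterior
  have hrad : ∀ i, IntegrableOn (fun x => d * f x + f' x (x - s.points i)) s.closedInterior :=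
    fun i => ((continuousOn_const.mul hfc).add
      (hf'.clm_apply (by fun_prop))).integrableOn_compact s.isCompact_closedInterior
  set I : Fin (d + 1) → ℝ := fun i => ∫ x in (s.faceOpposite i).closedInterior, f x
        ∂(Measure.euclideanHausdorffMeasure (d - 1)) with hI
  -- Both sides are linear in the direction `e`, so it suffices to compare them on the edges at
  -- vertex `0`.
  let A : Space d →ₗ[ℝ] ℝ :=
    { toFun := fun e => ∫ x in s.closedInterior, f' x e
      map_add' := fun a b => by
        simp only [map_add]; exact integral_add (hint a) (hint b)
      map_smul' := fun c a => by
        simp only [map_smul, smul_eq_mul, RingHom.id_apply]; exact integral_const_mul _ _ }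
  let B : Space d →ₗ[ℝ] ℝ :=
    { toFun := fun e => ∑ i, inner ℝ e (facetNormal s i) * I i
      map_add' := fun a b => by
        simp only [inner_add_left, add_mul, Finset.sum_add_distrib]
      map_smul' := fun c a => by
        simp only [inner_smul_left, RingHom.id_apply, smul_eq_mul, Finset.mul_sum, mul_assoc]
        rfl }
  suffices A = B from LinearMap.congr_fun this e
  refine LinearMap.ext_on_range (span_range_edges s) fun j => ?_
  by_cases hj : j = 0
  · simp [hj]
  -- The constant field `p_j - p_0` is the difference of the radial fields `x - p_0` and `x - p_j`;
  -- the terms `d * f x` cancel.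
  have hA : A (s.points j - s.points 0) = s.height 0 * I 0 - s.height j * I j := by
    simp only [hI]
    rw [← setIntegral_radial_divergence s 0 hf hf', ← setIntegral_radial_divergence s j hf hf',
      ← integral_sub (hrad 0) (hrad j)]
    refine integral_congr_ae (ae_of_all _ fun x => ?_)
    simp only [map_sub]
    ring
  have hB : B (s.points j - s.points 0) = s.height 0 * I 0 - s.height j * I j := by
    -- Both endpoints of the edge lie on the facet opposite `i`, so the edge is tangential to it.
    have h0 : ∀ i, i ≠ 0 → i ≠ j →
        inner ℝ (s.points j - s.points 0) (facetNormal s i) = 0 := by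
      intro i hi0 hij
      rw [← sub_sub_sub_cancel_right _ _ (s.points i), inner_sub_left,
        inner_edge_facetNormal s hij.symm, inner_edge_facetNormal s hi0.symm, sub_self]
    change ∑ i, inner ℝ (s.points j - s.points 0) (facetNormal s i) * I i = _
    rw [← Finset.sum_subset (Finset.subset_univ {0, j}) (fun i _ hi => by
      simp only [Finset.mem_insert, Finset.mem_singleton, not_or] at hi
      rw [h0 i hi.1 hi.2, zero_mul]), Finset.sum_pair (Ne.symm hj), inner_edge_facetNormal s hj,
      ← neg_sub (s.points 0), inner_neg_left, inner_edge_facetNormal s (Ne.symm hj)]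
    ring
  rw [hA, hB]

end Simplex

/-! ### Barycentric coordinates and normals of adjacent simplices -/

section Barycentric

variable {d : ℕ} (s : Affine.Simplex ℝ (Space d) d)

/-- The vertices of a full-dimensional simplex as an affine basis. -/
def vertexBasis : AffineBasis (Fin (d + 1)) ℝ (Space d) where
  toFun := s.points
  ind' := s.independent
  tot' := by
    rw [s.independent.affineSpan_eq_top_iff_card_eq_finrank_add_one]
    simp

lemma coe_vertexBasis : ⇑(vertexBasis s) = s.points := rfl

lemma mem_interior_closedInterior_iff {x : Space d} :
    x ∈ interior s.closedInterior ↔ ∀ i, 0 < (vertexBasis s).coord i x := by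
  rw [← Affine.Simplex.convexHull_eq_closedInterior, ← coe_vertexBasis,
    AffineBasis.interior_convexHull]
  rfl

/-- Positive coordinates summing to `1` are each below `1` as soon as there are two vertices, hence
the need for `d ≥ 1`. -/
lemma interior_closedInterior_subset [NeZero d] : interior s.closedInterior ⊆ s.interior := by
  intro x hx
  rw [mem_interior_closedInterior_iff] at hx
  rw [← (vertexBasis s).affineCombination_coord_eq_self x, coe_vertexBasis,
    Affine.Simplex.affineCombination_mem_interior_iff
      ((vertexBasis s).sum_coord_apply_eq_one x)]
  intro i
  refine ⟨hx i, ?_⟩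
  obtain ⟨j, hj⟩ : ∃ j : Fin (d + 1), j ≠ i := by
    have : Nontrivial (Fin (d + 1)) :=
      Fin.nontrivial_iff_two_le.2 (by have := NeZero.one_le (n := d); omega)
    exact exists_ne i
  rw [← (vertexBasis s).sum_coord_apply_eq_one x]
  exact Finset.single_lt_sum hj (Finset.mem_univ _) (Finset.mem_univ _) (hx j)
    fun k _ _ => (hx k).le

lemma centroid_mem_interior :
    Finset.univ.centroid ℝ s.points ∈ interior s.closedInterior := by
  rw [mem_interior_closedInterior_iff]
  intro i
  rw [← coe_vertexBasis, (vertexBasis s).coord_apply_centroid (Finset.mem_univ i)]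
  simp only [Finset.card_univ, Fintype.card_fin]
  positivity

lemma convex_closedInterior : Convex ℝ s.closedInterior := by
  rw [← Affine.Simplex.convexHull_eq_closedInterior]; exact convex_convexHull _ _

/-- The frontier of a convex set is null. A discrete function is prescribed as a polynomial only on
the closed simplex, so its gradient is controlled only at interior points. -/
lemma ae_mem_interior_closedInterior :
    ∀ᵐ x ∂(volume.restrict s.closedInterior), x ∈ interior s.closedInterior := by
  rw [ae_restrict_iff' s.isClosed_closedInterior.measurableSet]
  have h : ∀ᵐ x : Space d, x ∉ frontier s.closedInterior :=
    measure_eq_zero_iff_ae_notMem.1 ((convex_closedInterior s).addHaar_frontier volume)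
  filter_upwards [h] with x hx hxs
  by_contra hxi
  exact hx ⟨subset_closure hxs, hxi⟩

variable [NeZero d] (i : Fin (d + 1))

/-- Every edge from vertex `i` has normal component `height`, and the weights of the other vertices
sum to one minus the `i`-th. -/
lemma inner_sub_point_facetNormal_eq_coord (x : Space d) :
    inner ℝ (x - s.points i) (facetNormal s i) =
      s.height i * (1 - (vertexBasis s).coord i x) := by
  have hsum := (vertexBasis s).sum_coord_apply_eq_one x
  have hx : x - s.points i =
      ∑ k, (vertexBasis s).coord k x • (s.points k - s.points i) := by
    conv_lhs => rw [← (vertexBasis s).linear_combination_coord_eq_self x]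
    simp only [smul_sub, Finset.sum_sub_distrib, ← Finset.sum_smul, hsum, one_smul]
    rfl
  rw [hx, sum_inner, ← hsum, ← Finset.sum_erase_eq_sub (Finset.mem_univ i), Finset.mul_sum,
    ← Finset.add_sum_erase _ _ (Finset.mem_univ i)]
  simp only [sub_self, smul_zero, inner_zero_left, zero_add]
  refine Finset.sum_congr rfl fun k hk => ?_
  rw [inner_smul_left, inner_edge_facetNormal s (Finset.ne_of_mem_erase hk), mul_comm]
  rfl

/-- There is a point in the relative interior of each facet. -/
lemma exists_mem_facet_coord_pos : ∃ y ∈ (s.faceOpposite i).closedInterior,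
    ∀ k, k ≠ i → 0 < (vertexBasis s).coord k y := by
  have hc := centroid_mem_interior s
  -- The point is the centroid projected from vertex `i`. The coordinates `k ≠ i` vanish at that
  -- vertex, so those of the centroid are `θ` times those of `y`.
  obtain ⟨y, hy, θ, hθ, h⟩ :=
    (mem_closedInterior_iff_exists_faceOpposite s i).1 (interior_subset hc)
  refine ⟨y, hy, fun k hk => ?_⟩
  have hk' := (mem_interior_closedInterior_iff s).1 hc k
  have hl : AffineMap.lineMap (s.points i) y θ = Finset.univ.centroid ℝ s.points := by
    rw [← h, AffineMap.lineMap_apply, vsub_eq_sub, vadd_eq_add, add_comm]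
  have h0 : (vertexBasis s).coord k (s.points i) = 0 := (vertexBasis s).coord_apply_ne hk
  rw [← hl, AffineMap.apply_lineMap, h0, AffineMap.lineMap_apply] at hk'
  simp only [vsub_eq_sub, sub_zero, smul_eq_mul, vadd_eq_add, add_zero] at hk'
  exact pos_of_mul_pos_right hk' hθ.1

variable (s' : Affine.Simplex ℝ (Space d) d) (i' : Fin (d + 1))

/-- Both normals are orthogonal to the common facet directions, which span a hyperplane. The factor
`t` is fixed by comparing inner products with a vector from vertex `i` to the facet. -/
lemma facetNormal_eq_smul_of_translate {c : Space d}
    (hF : (s'.faceOpposite i').closedInterior =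
      (fun x => x + c) '' (s.faceOpposite i).closedInterior) :
    ∃ t : ℝ, facetNormal s' i' = t • facetNormal s i := by
  obtain ⟨y, hy, -⟩ := exists_mem_facet_coord_pos s i
  have horth : ∀ z ∈ (s.faceOpposite i).closedInterior,
      inner ℝ (z - y) (facetNormal s' i') = 0 := by
    intro z hz
    have h1 := inner_sub_point_facetNormal s' i' (Affine.Simplex.closedInterior_subset_affineSpan
      (hF ▸ mem_image_of_mem _ hz : z + c ∈ _))
    have h2 := inner_sub_point_facetNormal s' i' (Affine.Simplex.closedInterior_subset_affineSpan
      (hF ▸ mem_image_of_mem _ hy : y + c ∈ _))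
    rw [← add_sub_add_right_eq_sub z y c, ← sub_sub_sub_cancel_right _ _ (s'.points i'),
      inner_sub_left, h1, h2, sub_self]
  set t := inner ℝ (y - s.points i) (facetNormal s' i') / s.height i with ht
  have hh := (s.height_pos i).ne'
  refine ⟨t, sub_eq_zero.1 ?_⟩
  have hk : ∀ k, inner ℝ (s.points k - s.points i)
      (facetNormal s' i' - t • facetNormal s i) = 0 := by
    intro k
    by_cases hki : k = i
    · simp [hki]
    · have h1 := horth (s.points k) (s.point_mem_closedInterior_faceOpposite_iff.2 hki)
      rw [inner_sub_right, inner_smul_right, inner_edge_facetNormal s hki, ht,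
        div_mul_cancel₀ _ hh, ← sub_add_sub_cancel (s.points k) y, inner_add_left, h1]
      ring
  have hz : innerₛₗ ℝ (facetNormal s' i' - t • facetNormal s i) = 0 := by
    refine LinearMap.ext_on_range (span_range_edges s) fun k => ?_
    rw [innerₛₗ_apply_apply, real_inner_comm, ← sub_sub_sub_cancel_right _ _ (s.points i),
      inner_sub_left, hk, hk]
    simp
  have := LinearMap.congr_fun hz (facetNormal s' i' - t • facetNormal s i)
  rw [innerₛₗ_apply_apply, LinearMap.zero_apply] at this
  exact inner_self_eq_zero.1 this

/-- The outward normals of two simplices sharing a facet (up to a translation) are opposite if the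
interiors do not overlap. -/
lemma facetNormal_eq_neg_of_translate {c : Space d}
    (hF : (s'.faceOpposite i').closedInterior =
      (fun x => x + c) '' (s.faceOpposite i).closedInterior)
    (hdisj : ∀ x ∈ s.interior, x + c ∉ s'.interior) :
    facetNormal s' i' = -facetNormal s i := by
  obtain ⟨t, ht⟩ := facetNormal_eq_smul_of_translate s i s' i' hF
  have habs : |t| = 1 := by
    have := congrArg norm ht
    rwa [norm_smul, norm_facetNormal, norm_facetNormal, mul_one, Real.norm_eq_abs, eq_comm] at this
  rcases eq_or_eq_neg_of_abs_eq habs with h1 | h1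
  swap
  · rw [ht, h1, neg_one_smul]
  exfalso
  -- If the normals were equal, both simplices would lie on the same side of the facet and overlap
  -- there.
  rw [h1, one_smul] at ht
  obtain ⟨y, hy, hypos⟩ := exists_mem_facet_coord_pos s i
  have hy' : y + c ∈ (s'.faceOpposite i').closedInterior := hF ▸ mem_image_of_mem _ hy
  set q := Finset.univ.centroid ℝ s'.points with hq
  have hqi : q ∈ interior s'.closedInterior := centroid_mem_interior s'
  have hdir : inner ℝ (q - (y + c)) (facetNormal s i) < 0 := by
    rw [← ht, ← sub_sub_sub_cancel_right _ _ (s'.points i'), inner_sub_left,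
      inner_sub_point_facetNormal s' i' (Affine.Simplex.closedInterior_subset_affineSpan hy'),
      inner_sub_point_facetNormal_eq_coord]
    have := (mem_interior_closedInterior_iff s').1 hqi i'
    have := mul_pos (s'.height_pos i') this
    linarith
  -- From a relative interior point of the facet, move slightly towards the centroid of the second
  -- simplex, in the frame of the first. This enters the second simplex by convexity. In the first,
  -- the coordinates `k ≠ i` stay positive by continuity, and the `i`-th becomes positive by `hdir`.
  set z : ℝ → Space d := fun ε => y + ε • (q - (y + c)) with hz
  have hzc : Continuous z := by fun_prop
  have hev : ∀ᶠ ε in nhdsWithin (0 : ℝ) (Ioi 0),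
      ∀ k, k ≠ i → 0 < (vertexBasis s).coord k (z ε) := by
    rw [Filter.eventually_all]
    intro k
    by_cases hk : k = i
    · simp [hk]
    · have hc : Continuous fun ε => (vertexBasis s).coord k (z ε) :=
        ((vertexBasis s).coord k).continuous_of_finiteDimensional.comp hzc
      have h0 : 0 < (vertexBasis s).coord k (z 0) := by simpa [hz] using hypos k hk
      filter_upwards [nhdsWithin_le_nhds ((hc.tendsto 0).eventually (lt_mem_nhds h0))] with ε hε _
      exact hε
  obtain ⟨ε, hk, hε⟩ := (hev.and (Ioc_mem_nhdsGT (zero_lt_one' ℝ))).exists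
  have hint : z ε ∈ interior s.closedInterior := by
    rw [mem_interior_closedInterior_iff]
    intro k
    by_cases hki : k = i
    · subst hki
      have e1 := inner_sub_point_facetNormal_eq_coord s k (z ε)
      rw [hz] at e1
      simp only [add_sub_right_comm] at e1
      rw [inner_add_left, inner_sub_point_facetNormal s k
        (Affine.Simplex.closedInterior_subset_affineSpan hy), inner_smul_left] at e1
      have e2 := mul_neg_of_pos_of_neg hε.1 hdir
      have e3 : s.height k * (vertexBasis s).coord k (z ε) =
          -(ε * inner ℝ (q - (y + c)) (facetNormal s k)) := by
        simp only [hz, RCLike.conj_to_real] at e1 ⊢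
        linarith
      exact pos_of_mul_pos_right (by rw [e3]; linarith) (s.height_pos k).le
    · exact hk k hki
  have hint' : z ε + c ∈ interior s'.closedInterior := by
    have := (convex_closedInterior s').add_smul_sub_mem_interior
      (s'.closedInterior_faceOpposite_subset_closedInterior i' hy') hqi hε
    convert! this using 1
    simp only [hz]; abel
  exact hdisj _ (interior_closedInterior_subset s hint) (interior_closedInterior_subset s' hint')

end Barycentric

/-! ### Identified facets of the mesh -/

section MeshFacets

variable {d : ℕ} [NeZero d] {ι κ : Type*} (M : PeriodicMacroMesh d ι κ)

lemma normal_nbr (f : ι × Fin (d + 1)) : M.normal (M.nbr f) = -M.normal f := by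
  refine facetNormal_eq_neg_of_translate _ _ _ _ (M.facet_nbr f) fun x hx hx' => ?_
  -- An overlap would make `f` and `nbr f` two different facets of one simplex with the same point
  -- set; but vertex `f.2` lies on the facet opposite any other vertex and not on its own.
  obtain ⟨hK, hl⟩ := M.interiors_disjoint _ _ _ (M.shift_mem f) x hx hx'
  have hF := M.facet_nbr f
  simp only [hl, add_zero, image_id', ← hK] at hF
  have hne : (M.nbr f).2 ≠ f.2 := fun h => M.nbr_ne f (Prod.ext hK.symm h)
  have h1 := ((M.elem f.1).point_mem_closedInterior_faceOpposite_iff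
    (i := (M.nbr f).2) (j := f.2)).2 hne.symm
  rw [hF] at h1
  exact (M.elem f.1).point_mem_closedInterior_faceOpposite_iff.1 h1 rfl

lemma isInterface_nbr {f : ι × Fin (d + 1)} (hf : M.IsInterface f) : M.IsInterface (M.nbr f) := by
  intro h
  rw [M.nbr_nbr, M.shift_nbr, neg_eq_zero] at h
  exact hf ⟨h.1.symm, h.2⟩

lemma setIntegral_facet_nbr (f : ι × Fin (d + 1)) (g : Space d → ℝ) :
    ∫ x, g x ∂(M.facetMeasure (M.nbr f)) = ∫ x, g (x + M.shift f) ∂(M.facetMeasure f) := by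
  rw [PeriodicMacroMesh.facetMeasure, PeriodicMacroMesh.facet, M.facet_nbr]
  exact (measurePreserving_add_right (Measure.euclideanHausdorffMeasure (d - 1))
    (M.shift f)).setIntegral_image_emb (measurableEmbedding_addRight _) _ _

lemma isCompact_facet (f : ι × Fin (d + 1)) : IsCompact (M.facet f) :=
  Affine.Simplex.isCompact_closedInterior _

lemma facet_subset_cell (f : ι × Fin (d + 1)) : M.facet f ⊆ M.cell f.1 :=
  (M.elem f.1).closedInterior_faceOpposite_subset_closedInterior f.2

lemma integrable_facetMeasure {f : ι × Fin (d + 1)} {g : Space d → ℝ}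
    (hg : ContinuousOn g (M.facet f)) : Integrable g (M.facetMeasure f) := by
  have : IsFiniteMeasure (M.facetMeasure f) := isFiniteMeasure_restrict_facet _ _
  have h1 : IntegrableOn (fun _ => (1 : ℝ)) (M.facet f)
      (Measure.euclideanHausdorffMeasure (d - 1)) := integrable_const (μ := M.facetMeasure f) 1
  simpa using! h1.continuousOn_mul hg (isCompact_facet M f)

end MeshFacets

/-! ### Interpolation of polynomials on arbitrary sets -/

section Interpolation

/-- A finite-dimensional space of functions is unisolvent for some finite set of points. -/
lemma exists_interpolation {X : Type*} (W : Submodule ℝ (X → ℝ)) [FiniteDimensional ℝ W] :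
    ∃ (n : ℕ) (y : Fin n → X) (ℓ : Fin n → X → ℝ), (∀ i, ℓ i ∈ W) ∧
      ∀ f ∈ W, ∀ x, f x = ∑ i, f (y i) * ℓ i x := by
  let ev : X → Module.Dual ℝ W := fun x => (LinearMap.proj x : (X → ℝ) →ₗ[ℝ] ℝ).comp W.subtype
  -- Finitely many evaluations span all of them, so a function vanishing at these nodes is zero. A
  -- left inverse of nodal evaluation then supplies the functions `ℓ`.
  obtain ⟨b, hb, hspan, -⟩ := Submodule.exists_fun_fin_finrank_span_eq ℝ (range ev)
  choose y hy using hb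
  let e : W →ₗ[ℝ] (Fin _ → ℝ) := LinearMap.pi b
  have he : LinearMap.ker e = ⊥ := by
    rw [LinearMap.ker_eq_bot']
    intro f hf
    have h : ∀ φ ∈ Submodule.span ℝ (range b), φ f = 0 := by
      intro φ hφ
      induction hφ using Submodule.span_induction with
      | mem φ h => obtain ⟨i, rfl⟩ := h; exact congrFun hf i
      | zero => rfl
      | add φ ψ _ _ h1 h2 => rw [LinearMap.add_apply, h1, h2, add_zero]
      | smul c φ _ h1 => rw [LinearMap.smul_apply, h1, smul_zero]
    rw [hspan] at h
    ext x
    exact h _ (Submodule.subset_span ⟨x, rfl⟩)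
  obtain ⟨g, hg⟩ := e.exists_leftInverse_of_injective he
  refine ⟨_, y, fun i => g (Pi.single i 1), fun i => (g _).2, fun f hf x => ?_⟩
  have h1 : g (e ⟨f, hf⟩) = ⟨f, hf⟩ := LinearMap.congr_fun hg ⟨f, hf⟩
  have h2 : e ⟨f, hf⟩ = ∑ i, f (y i) • Pi.single i (1 : ℝ) := by
    ext i
    have : b i ⟨f, hf⟩ = f (y i) := by rw [← hy i]; rfl
    simp [e, this, Pi.single_apply]
  rw [h2, map_sum] at h1
  have h3 := congrFun (congrArg Subtype.val h1) x
  simp only [map_smul, Submodule.coe_sum, Submodule.coe_smul, Finset.sum_apply, Pi.smul_apply,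
    smul_eq_mul] at h3
  exact h3.symm

variable {d : ℕ}

/-- Evaluation of polynomials on a set, as a linear map. -/
def evalOn (S : Set (Space d)) : MvPolynomial (Fin d) ℝ →ₗ[ℝ] (S → ℝ) where
  toFun P x := MvPolynomial.eval (fun j => x.1 j) P
  map_add' P Q := by ext; simp
  map_smul' c P := by ext; simp

/-- The polynomials of total degree at most `p`, restricted to `S`. -/
def polyOn (p : ℕ) (S : Set (Space d)) : Submodule ℝ (S → ℝ) :=
  (MvPolynomial.restrictTotalDegree (Fin d) ℝ p).map (evalOn S)

instance (p : ℕ) (S : Set (Space d)) : FiniteDimensional ℝ (polyOn p S) := by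
  unfold polyOn; infer_instance

lemma contDiff_eval (P : MvPolynomial (Fin d) ℝ) :
    ContDiff ℝ 1 fun x : Space d => MvPolynomial.eval (fun j => x j) P := by
  induction P using MvPolynomial.induction_on with
  | C a => simpa using contDiff_const
  | add P Q hP hQ => simpa using hP.add hQ
  | mul_X P j hP =>
    have hx : ContDiff ℝ 1 fun x : Space d => x j := by fun_prop
    simpa using hP.mul hx

lemma continuous_of_mem_polyOn {p : ℕ} {S : Set (Space d)} {f : S → ℝ} (hf : f ∈ polyOn p S) :
    Continuous f := by
  obtain ⟨P, -, rfl⟩ := hf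
  exact (contDiff_eval P).continuous.comp continuous_subtype_val

open PeriodicMacroMesh in
-- Nodes and weights depend only on `p` and `S`. For a time-dependent polynomial, all time
-- dependence thus sits in finitely many nodal values.
lemma exists_interpolation_of_isPolyOn (p : ℕ) (S : Set (Space d)) :
    ∃ (n : ℕ) (y : Fin n → Space d) (ℓ : Fin n → Space d → ℝ), (∀ i, y i ∈ S) ∧
      (∀ i, ContinuousOn (ℓ i) S) ∧
      ∀ w : Space d → State d, IsPolyOn p S w → ∀ x ∈ S, w x = ∑ i, ℓ i x • w (y i) := by
  classical
  obtain ⟨n, y, ℓ, hℓ, h⟩ := exists_interpolation (polyOn p S)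
  refine ⟨n, fun i => y i, fun i x => if hx : x ∈ S then ℓ i ⟨x, hx⟩ else 0, fun i => (y i).2,
    fun i => ?_, fun w hw x hx => ?_⟩
  · rw [continuousOn_iff_continuous_domRestrict]
    convert! continuous_of_mem_polyOn (hℓ i) using 1
    ext x
    simp
  · ext c
    obtain ⟨P, hP, hPw⟩ := hw c
    have := h (evalOn S P) ⟨P, (MvPolynomial.mem_restrictTotalDegree _ _ _).2 hP, rfl⟩ ⟨x, hx⟩
    simp only [evalOn, LinearMap.coe_mk, AddHom.coe_mk] at this
    rw [hPw x hx, this, Finset.sum_apply]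
    refine Finset.sum_congr rfl fun i _ => ?_
    simp [hx, hPw _ (y i).2, mul_comm]

end Interpolation

/-! ### Differentiating space integrals in time -/

section TimeDerivative

/-- A `C¹` function is uniformly Lipschitz around the points of a compact set. -/
lemma exists_uniform_lipschitz {E : Type*} [NormedAddCommGroup E] [NormedSpace ℝ E] {G : E → ℝ}
    {K : Set E} (hK : IsCompact K) (hG : ∀ y ∈ K, ContDiffAt ℝ 1 G y) :
    ∃ δ > 0, ∃ L ≥ 0, ∀ y ∈ K, ∀ z, ‖z - y‖ < δ → |G z - G y| ≤ L * ‖z - y‖ := by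
  refine hK.induction_on (p := fun A =>
    ∃ δ > 0, ∃ L ≥ 0, ∀ y ∈ A, ∀ z, ‖z - y‖ < δ → |G z - G y| ≤ L * ‖z - y‖) ?_ ?_ ?_ ?_
  · exact ⟨1, one_pos, 0, le_rfl, by simp⟩
  · rintro A B hAB ⟨δ, hδ, L, hL, h⟩
    exact ⟨δ, hδ, L, hL, fun y hy => h y (hAB hy)⟩
  · rintro A B ⟨δ, hδ, L, hL, h⟩ ⟨δ', hδ', L', hL', h'⟩
    refine ⟨min δ δ', lt_min hδ hδ', max L L', hL.trans (le_max_left _ _), ?_⟩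
    rintro y (hy | hy) z hz
    · exact (h y hy z (hz.trans_le (min_le_left _ _))).trans (by gcongr; exact le_max_left _ _)
    · exact (h' y hy z (hz.trans_le (min_le_right _ _))).trans (by gcongr; exact le_max_right _ _)
  · intro y hy
    obtain ⟨L, t, ht, hL⟩ := (hG y hy).exists_lipschitzOnWith
    obtain ⟨ε, hε, hball⟩ := Metric.mem_nhds_iff.1 ht
    -- Halving the radius keeps both `a` and any `z` within `ε / 2` of it in the ball where `G` is
    -- Lipschitz.
    refine ⟨Metric.ball y (ε / 2), mem_nhdsWithin_of_mem_nhds (Metric.ball_mem_nhds _ (by positivity)),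
      ε / 2, by positivity, L, L.2, fun a ha z hz => ?_⟩
    rw [← dist_eq_norm] at hz
    have h1 : a ∈ t := hball (Metric.ball_subset_ball (by linarith) ha)
    have h2 : z ∈ t := hball (by
      rw [Metric.mem_ball] at ha ⊢
      linarith [dist_triangle z a y])
    simpa [Real.dist_eq, dist_eq_norm] using hL.dist_le_mul z h2 a h1

open PeriodicMacroMesh in
/-- Differentiation under the integral for time-dependent polynomials which are differentiable in
time at each point. -/
lemma hasDerivWithinAt_setIntegral_comp_poly {d p : ℕ} {S : Set (Space d)} (hS : IsCompact S)
    {I : Set ℝ} {v : ℝ → Space d → State d} (hpoly : ∀ r ∈ I, IsPolyOn p S (v r))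
    (hdiff : ∀ x ∈ S, DifferentiableOn ℝ (fun r => v r x) I) {G : State d → ℝ}
    (hG : ∀ r ∈ I, ∀ x ∈ S, ContDiffAt ℝ 1 G (v r x)) {D : Space d → ℝ} {t : ℝ} (ht : t ∈ I)
    (hD : ∀ x ∈ S, HasDerivWithinAt (fun r => G (v r x)) (D x) I t) :
    HasDerivWithinAt (fun r => ∫ x in S, G (v r x)) (∫ x in S, D x) I t := by
  obtain ⟨n, y, ℓ, hy, hℓ, hint⟩ := exists_interpolation_of_isPolyOn (d := d) p S
  have hcont : ∀ r ∈ I, ContinuousOn (v r) S := fun r hr =>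
    (continuousOn_finsetSum _ fun i _ => (hℓ i).smul continuousOn_const).congr
      fun x hx => hint _ (hpoly r hr) x hx
  have hcontG : ∀ r ∈ I, ContinuousOn (fun x => G (v r x)) S := fun r hr x hx =>
    (hG r hr x hx).continuousAt.comp_continuousWithinAt (hcont r hr x hx)
  have hintG : ∀ r ∈ I, IntegrableOn (fun x => G (v r x)) S := fun r hr =>
    (hcontG r hr).integrableOn_compact hS
  -- Difference quotients of `v` are bounded, uniformly on `S`.
  obtain ⟨C, hC⟩ : ∃ C, ∀ᶠ r in nhdsWithin t I, ∀ x ∈ S, ‖v r x - v t x‖ ≤ C * |r - t| := by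
    have hb : ∀ i, ∃ B, ∀ x ∈ S, ‖ℓ i x‖ ≤ B := fun i => hS.exists_bound_of_continuousOn (hℓ i)
    choose B hB using hb
    -- Pointwise differentiability is used only at the finitely many nodes, so these bounds hold
    -- simultaneously near `t`.
    have hO : ∀ i, ∃ c > 0, ∀ᶠ r in nhdsWithin t I, ‖v r (y i) - v t (y i)‖ ≤ c * ‖r - t‖ :=
      fun i => ((hdiff _ (hy i) t ht).hasDerivWithinAt.isBigO_sub).exists_pos.imp
        fun c hc => ⟨hc.1, by simpa [Filter.prod_pure] using hc.2.bound⟩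
    choose c hc0 hc using hO
    refine ⟨∑ i, |B i| * c i, ?_⟩
    filter_upwards [Filter.eventually_all.2 hc, self_mem_nhdsWithin] with r hr hrI x hx
    rw [hint _ (hpoly r hrI) x hx, hint _ (hpoly t ht) x hx, ← Finset.sum_sub_distrib,
      Finset.sum_mul]
    refine norm_sum_le_of_le _ fun i _ => ?_
    rw [← smul_sub, norm_smul, mul_assoc]
    exact mul_le_mul ((hB i x hx).trans (le_abs_self _)) (hr i) (norm_nonneg _) (abs_nonneg _)
  obtain ⟨δ, hδ, L, hL, hlip⟩ := exists_uniform_lipschitz (hS.image_of_continuousOn (hcont t ht))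
    (G := G) (by rintro _ ⟨x, hx, rfl⟩; exact hG t ht x hx)
  have hsmall : ∀ᶠ r in nhdsWithin t I, C * |r - t| < δ := by
    have h : Filter.Tendsto (fun r => C * |r - t|) (nhds t) (nhds (C * |t - t|)) :=
      (by fun_prop : Continuous fun r => C * |r - t|).tendsto t
    rw [sub_self, abs_zero, mul_zero] at h
    exact nhdsWithin_le_nhds (h.eventually (gt_mem_nhds hδ))
  have hsub : nhdsWithin t (I \ {t}) ≤ nhdsWithin t I := nhdsWithin_mono _ sdiff_subset
  rw [hasDerivWithinAt_iff_tendsto_slope]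
  have key : Filter.Tendsto (fun r => ∫ x in S, slope (fun r => G (v r x)) t r)
      (nhdsWithin t (I \ {t})) (nhds (∫ x in S, D x)) := by
    -- The dominating constant is the local Lipschitz constant of `G` times the uniform bound on the
    -- difference quotients of `v`.
    refine tendsto_integral_filter_of_dominated_convergence (fun _ => L * C) ?_ ?_ ?_ ?_
    · filter_upwards [self_mem_nhdsWithin] with r hr
      simp only [slope_def_field]
      exact (((hintG r hr.1).sub (hintG t ht)).div_const _).aestronglyMeasurable
    · filter_upwards [self_mem_nhdsWithin, hsub hC, hsub hsmall] with r hr hrC hrδ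
      rw [ae_restrict_iff' hS.isClosed.measurableSet]
      refine ae_of_all _ fun x hx => ?_
      have hrt : 0 < |r - t| := abs_pos.2 (sub_ne_zero.2 hr.2)
      rw [slope_def_field, norm_div, Real.norm_eq_abs, Real.norm_eq_abs, div_le_iff₀ hrt]
      refine (hlip _ (mem_image_of_mem _ hx) _ ((hrC x hx).trans_lt hrδ)).trans ?_
      rw [mul_assoc]
      exact mul_le_mul_of_nonneg_left (hrC x hx) hL
    · exact integrableOn_const hS.measure_lt_top.ne
    · rw [ae_restrict_iff' hS.isClosed.measurableSet]
      exact ae_of_all _ fun x hx => hasDerivWithinAt_iff_tendsto_slope.1 (hD x hx)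
  refine key.congr' ?_
  filter_upwards [self_mem_nhdsWithin] with r hr
  simp only [slope_def_field]
  rw [integral_div, integral_sub (hintG r hr.1) (hintG t ht)]

end TimeDerivative

/-! ### The volume term as a boundary integral of the entropy potential -/

section VolumeTerm

open PeriodicMacroMesh

variable {d : ℕ} {γ : ℝ}

lemma continuousOn_of_isPolyOn {p : ℕ} {S : Set (Space d)} {w : Space d → State d}
    (hw : IsPolyOn p S w) : ContinuousOn w S := by
  rw [continuousOn_pi]
  intro c
  obtain ⟨P, -, hP⟩ := hw c
  exact (contDiff_eval P).continuous.continuousOn.congr hP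

lemma exists_contDiff_of_isPolyOn {p : ℕ} {S : Set (Space d)} {w : Space d → State d}
    (hw : IsPolyOn p S w) : ∃ W : Space d → State d, ContDiff ℝ 1 W ∧ ∀ x ∈ S, w x = W x := by
  choose P _ hP using hw
  exact ⟨fun x c => MvPolynomial.eval (fun j => x j) (P c),
    contDiff_pi.2 fun c => contDiff_eval (P c), fun x hx => funext fun c => hP c x hx⟩

lemma continuousOn_potential {S : Set (Space d)} {w : Space d → State d} (hw : ContinuousOn w S)
    (hadm : ∀ x ∈ S, Admissible (w x)) (j : Fin d) :
    ContinuousOn (fun x => potential γ (w x) j) S := fun x hx =>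
  (contDiffAt_potential (hadm x hx) j).continuousAt.comp_continuousWithinAt (hw x hx)

/-- `∂_j Ψ_j(w) = F_j · ∂_j w`. -/
lemma fderiv_potential_comp (hγ : 1 < γ) {W : Space d → State d} (hW : ContDiff ℝ 1 W)
    {x : Space d} (hx : Admissible (W x)) (j : Fin d) :
    fderiv ℝ (fun y => potential γ (W y) j) x (EuclideanSpace.single j 1) =
      ∑ c, flux γ (consVars γ (W x)) j c * partialDeriv W j c x := by
  set e : Space d := EuclideanSpace.single j 1
  -- Restricting to a coordinate line reduces the claim to the chain rule for `Ψ_j` along a curve of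
  -- states.
  have hline : HasDerivAt (fun r : ℝ => x + r • e) e 0 := by
    simpa using ((hasDerivAt_id (0 : ℝ)).smul_const e).const_add x
  have hx0 : x = x + (0 : ℝ) • e := by simp
  have hf : HasFDerivAt (fun y => potential γ (W y) j)
      (fderiv ℝ (fun y => potential γ (W y) j) x) (x + (0 : ℝ) • e) := by
    rw [← hx0]
    exact (((contDiffAt_potential hx j).comp x hW.contDiffAt).differentiableAt
      one_ne_zero).hasFDerivAt
  have h1 := hf.comp_hasDerivAt (0 : ℝ) hline
  have hWc : HasDerivAt (fun r : ℝ => W (x + r • e)) (fun c => partialDeriv W j c x) 0 := by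
    rw [hasDerivAt_pi]
    intro c
    have hc : HasFDerivAt (fun y => W y c) (fderiv ℝ (fun y => W y c) x) (x + (0 : ℝ) • e) := by
      rw [← hx0]
      exact ((contDiff_pi.1 hW c).differentiable one_ne_zero x).hasFDerivAt
    exact hc.comp_hasDerivAt (0 : ℝ) hline
  have h2 := (hasDerivWithinAt_potential hγ (hWc.hasDerivWithinAt (s := univ))
    (by simpa using hx) j).hasDerivAt Filter.univ_mem
  rw [← hx0] at h2
  exact h1.unique h2

variable [NeZero d]

/-- `(F(u(w)), ∇w)_K = ⟨Ψ_n(w), 1⟩_{∂K}` on each simplex. -/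
lemma setIntegral_flux_grad (hγ : 1 < γ) {p : ℕ} (s : Affine.Simplex ℝ (Space d) d)
    {w : Space d → State d} (hw : IsPolyOn p s.closedInterior w)
    (hadm : ∀ x ∈ s.closedInterior, Admissible (w x)) :
    ∫ x in s.closedInterior, ∑ j, ∑ c, flux γ (consVars γ (w x)) j c * partialDeriv w j c x =
      ∑ i, ∫ x in (s.faceOpposite i).closedInterior,
        inner ℝ (potential γ (w x)) (facetNormal s i)
          ∂(Measure.euclideanHausdorffMeasure (d - 1)) := by
  obtain ⟨W, hW, hwW⟩ := exists_contDiff_of_isPolyOn hw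
  have hadmW : ∀ x ∈ s.closedInterior, Admissible (W x) := fun x hx => hwW x hx ▸ hadm x hx
  set f : Fin d → Space d → ℝ := fun j y => potential γ (W y) j
  have hfc : ∀ j, ∀ x ∈ s.closedInterior, ContDiffAt ℝ 1 (f j) x := fun j x hx =>
    (contDiffAt_potential (hadmW x hx) j).comp x hW.contDiffAt
  have hf : ∀ j, ∀ x ∈ s.closedInterior, HasFDerivAt (f j) (fderiv ℝ (f j) x) x :=
    fun j x hx => ((hfc j x hx).differentiableAt one_ne_zero).hasFDerivAt
  have hf' : ∀ j, ContinuousOn (fderiv ℝ (f j)) s.closedInterior := fun j x hx =>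
    ((hfc j x hx).continuousAt_fderiv one_ne_zero).continuousWithinAt
  have hvol : ∫ x in s.closedInterior,
      ∑ j, ∑ c, flux γ (consVars γ (w x)) j c * partialDeriv w j c x =
      ∫ x in s.closedInterior, ∑ j, fderiv ℝ (f j) x (EuclideanSpace.single j 1) := by
    -- Near interior points `w` equals its polynomial extension `W`, so the gradients agree almost
    -- everywhere.
    refine integral_congr_ae ?_
    filter_upwards [ae_mem_interior_closedInterior s] with x hx
    have hxs := interior_subset hx
    refine Finset.sum_congr rfl fun j _ => ?_
    rw [fderiv_potential_comp hγ hW (hadmW x hxs), hwW x hxs]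
    refine Finset.sum_congr rfl fun c _ => ?_
    congr 1
    have hev : (fun y => w y c) =ᶠ[nhds x] fun y => W y c := by
      filter_upwards [mem_interior_iff_mem_nhds.1 hx] with y hy
      rw [hwW y hy]
    simp only [partialDeriv, hev.fderiv_eq]
  rw [hvol, integral_finsetSum]
  swap
  · exact fun j _ => ((hf' j).clm_apply continuousOn_const).integrableOn_compact
      s.isCompact_closedInterior
  simp only [setIntegral_directional_derivative s (hf _) (hf' _)]
  rw [Finset.sum_comm]
  refine Finset.sum_congr rfl fun i _ => ?_
  have hsub := s.closedInterior_faceOpposite_subset_closedInterior i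
  have hfin := isFiniteMeasure_restrict_facet s i
  have hint : ∀ j, Integrable (f j) ((Measure.euclideanHausdorffMeasure (d - 1)).restrict
      (s.faceOpposite i).closedInterior) := fun j => by
    have h1 : IntegrableOn (fun _ => (1 : ℝ)) (s.faceOpposite i).closedInterior
      (Measure.euclideanHausdorffMeasure (d - 1)) := integrable_const _
    simpa using! h1.continuousOn_mul (((continuousOn_potential hW.continuous.continuousOn
      hadmW j)).mono hsub) (s.faceOpposite i).isCompact_closedInterior
  simp only [← integral_const_mul]
  rw [← integral_finsetSum _ fun j _ => (hint j).const_mul _]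
  refine setIntegral_congr_fun (s.faceOpposite i).isClosed_closedInterior.measurableSet
    fun x hx => ?_
  simp only [hwW x (hsub hx), PiLp.inner_apply, f]
  simp

end VolumeTerm

/-! ### Entropy balance of the scheme -/

section Entropy

variable {d : ℕ} [NeZero d] {ι κ : Type*} [Fintype ι] (M : PeriodicMacroMesh d ι κ)

lemma mem_interfaceFacets {f : ι × Fin (d + 1)} :
    f ∈ M.interfaceFacets ↔ M.IsInterface f := by
  classical
  simp [PeriodicMacroMesh.interfaceFacets]

/-- A function which is single-valued on identified facets has vanishing total normal flux. -/
lemma sum_interface_normal_flux_eq_zero {Φ : ι × Fin (d + 1) → Space d → Space d}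
    (hΦ : ∀ f ∈ M.interfaceFacets, ∀ x ∈ M.facet f, Φ (M.nbr f) (x + M.shift f) = Φ f x) :
    ∑ f ∈ M.interfaceFacets, ∫ x, inner ℝ (Φ f x) (M.normal f) ∂(M.facetMeasure f) = 0 := by
  -- Identified facets are paired by a fixed-point-free involution; within a pair the values agree
  -- and the normals are opposite.
  refine Finset.sum_involution (fun f _ => M.nbr f) (fun f hf => ?_) (fun f _ _ => M.nbr_ne f)
    (fun f hf => (mem_interfaceFacets M).2 (isInterface_nbr M ((mem_interfaceFacets M).1 hf)))
    (fun f _ => M.nbr_nbr f)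
  have h : ∫ x, inner ℝ (Φ (M.nbr f) (x + M.shift f)) (-M.normal f) ∂(M.facetMeasure f) =
      ∫ x, -inner ℝ (Φ f x) (M.normal f) ∂(M.facetMeasure f) := by
    refine setIntegral_congr_fun (isCompact_facet M f).isClosed.measurableSet fun x hx => ?_
    simp only [hΦ f hf x hx, inner_neg_right]
  rw [setIntegral_facet_nbr, normal_nbr, h, integral_neg, add_neg_cancel]

/-- The fluxes through the facets interior to the macro-elements cancel. -/
lemma sum_facets_normal_flux (Φ : κ → Space d → Space d) :
    ∑ f : ι × Fin (d + 1), ∫ x, inner ℝ (Φ (M.macroOf f.1) x) (M.normal f) ∂(M.facetMeasure f) =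
      ∑ f ∈ M.interfaceFacets,
        ∫ x, inner ℝ (Φ (M.macroOf f.1) x) (M.normal f) ∂(M.facetMeasure f) := by
  classical
  rw [← Finset.sum_compl_add_sum M.interfaceFacets, add_eq_right]
  have hmem : ∀ f, f ∈ M.interfaceFacetsᶜ ↔
      (M.macroOf (M.nbr f).1 = M.macroOf f.1 ∧ M.shift f = 0) := fun f => by
    rw [Finset.mem_compl, mem_interfaceFacets, PeriodicMacroMesh.IsInterface, not_not]
  refine Finset.sum_involution (fun f _ => M.nbr f) (fun f hf => ?_) (fun f _ _ => M.nbr_ne f)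
    (fun f hf => ?_) (fun f _ => M.nbr_nbr f)
  · obtain ⟨h1, h2⟩ := (hmem f).1 hf
    rw [setIntegral_facet_nbr, normal_nbr, h1, h2]
    simp only [add_zero, inner_neg_right, integral_neg, add_neg_cancel]
  · obtain ⟨h1, h2⟩ := (hmem f).1 hf
    refine (hmem _).2 ⟨?_, ?_⟩
    · rw [M.nbr_nbr, h1]
    · rw [M.shift_nbr, h2, neg_zero]

variable {M} {p : ℕ} {γ T : ℝ} {Fhat : State d → State d → Space d → State d}
  {v : ℝ → κ → Space d → State d} {vhat : ℝ → ι × Fin (d + 1) → Space d → State d}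

/-- The time derivative of the total entropy is the term `(∂u/∂t, v)`. -/
lemma IsSolution.hasDerivWithinAt_totalEntropy_volume (hγ : 1 < γ)
    (hsol : IsSolution M p γ Fhat T v vhat) {t : ℝ} (ht : t ∈ Icc 0 T) :
    HasDerivWithinAt (fun r => totalEntropy M γ (v r))
      (∑ K, ∫ x in M.cell K,
        dot (derivWithin (fun r => consVars γ (v r (M.macroOf K) x)) (Icc 0 T) t)
          (v t (M.macroOf K) x)) (Icc 0 T) t := by
  refine HasDerivWithinAt.fun_sum fun K _ => ?_
  refine hasDerivWithinAt_setIntegral_comp_poly (p := p)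
    (G := fun w => entropy γ (consVars γ w)) (M.elem K).isCompact_closedInterior
    (v := fun r => v r (M.macroOf K)) (fun r hr => (hsol.memV r hr).2 K)
    (hsol.differentiable K)
    (fun r hr x hx => contDiffAt_entropy_consVars hγ (hsol.admissible r hr K x hx)) ht
    fun x hx => ?_
  have hu : DifferentiableWithinAt ℝ (fun r => consVars γ (v r (M.macroOf K) x)) (Icc 0 T) t :=
    ((contDiffAt_consVars hγ (hsol.admissible t ht K x hx)).differentiableAt
      one_ne_zero).comp_differentiableWithinAt (f := fun r => v r (M.macroOf K) x) t
      (hsol.differentiable K x hx t ht)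
  have h := hasDerivWithinAt_entropy hγ hu.hasDerivWithinAt
    (fun r hr => physical_consVars hγ (hsol.admissible r hr K x hx)) ht
  rwa [entropyVars_consVars hγ (hsol.admissible t ht K x hx)] at h

/-- The entropy balance: only the residual on the interfaces contributes. -/
lemma IsSolution.hasDerivWithinAt_totalEntropy (hγ : 1 < γ)
    (hsol : IsSolution M p γ Fhat T v vhat) {t : ℝ} (ht : t ∈ Icc 0 T) :
    HasDerivWithinAt (fun r => totalEntropy M γ (v r))
      (∑ f ∈ M.interfaceFacets, ∫ x,
        entropyResidual γ Fhat (vhat t f x) (v t (M.macroOf f.1) x) (M.normal f)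
          ∂(M.facetMeasure f)) (Icc 0 T) t := by
  refine (hsol.hasDerivWithinAt_totalEntropy_volume hγ ht).congr_deriv ?_
  -- The solution itself is the test function: `w = v_h` here and `μ = v̂_h` in the next line.
  have hbal := hsol.balance t ht (v t) (hsol.memV t ht)
  have htrans := hsol.transmission t ht (vhat t) (hsol.memM t ht)
  have hvol : (∑ K, ∫ x in M.cell K, ∑ j, ∑ c,
      flux γ (consVars γ (v t (M.macroOf K) x)) j c * partialDeriv (v t (M.macroOf K)) j c x) =
      ∑ f ∈ M.interfaceFacets, ∫ x,
        inner ℝ (potential γ (v t (M.macroOf f.1) x)) (M.normal f) ∂(M.facetMeasure f) := by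
    rw [← sum_facets_normal_flux M (fun m x => potential γ (v t m x)), Fintype.sum_prod_type]
    exact Finset.sum_congr rfl fun K _ => setIntegral_flux_grad hγ (M.elem K)
      ((hsol.memV t ht).2 K) (hsol.admissible t ht K)
  have hhat : ∑ f ∈ M.interfaceFacets, ∫ x,
      inner ℝ (potential γ (vhat t f x)) (M.normal f) ∂(M.facetMeasure f) = 0 :=
    sum_interface_normal_flux_eq_zero M (Φ := fun f x => potential γ (vhat t f x))
      fun f hf x hx => by rw [(hsol.memM t ht f hf).2 x hx]
  have hpot : ∀ f (w : Space d → State d), ContinuousOn w (M.facet f) →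
      (∀ x ∈ M.facet f, Admissible (w x)) →
      Integrable (fun x => inner ℝ (potential γ (w x)) (M.normal f)) (M.facetMeasure f) := by
    intro f w hw hadm
    refine integrable_facetMeasure M ?_
    simp only [PiLp.inner_apply]
    exact continuousOn_finsetSum _ fun j _ =>
      (continuousOn_potential hw hadm j).inner continuousOn_const
  have hdot : ∀ f ∈ M.interfaceFacets, ∀ w : Space d → State d, ContinuousOn w (M.facet f) →
      Integrable (fun x => dot (Fhat (vhat t f x) (v t (M.macroOf f.1) x) (M.normal f)) (w x))
        (M.facetMeasure f) := by
    intro f hf w hw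
    refine integrable_finsetSum _ fun c _ => ?_
    have hF : IntegrableOn (fun x => Fhat (vhat t f x) (v t (M.macroOf f.1) x) (M.normal f) c)
      (M.facet f) (Measure.euclideanHausdorffMeasure (d - 1)) :=
      (hsol.flux_integrable t ht f hf).eval c
    exact hF.mul_continuousOn (continuousOn_pi.1 hw c) (isCompact_facet M f)
  have hres : ∀ f ∈ M.interfaceFacets, ∫ x,
      entropyResidual γ Fhat (vhat t f x) (v t (M.macroOf f.1) x) (M.normal f)
        ∂(M.facetMeasure f) =
      ∫ x, dot (Fhat (vhat t f x) (v t (M.macroOf f.1) x) (M.normal f)) (vhat t f x)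
        ∂(M.facetMeasure f) -
      ∫ x, dot (Fhat (vhat t f x) (v t (M.macroOf f.1) x) (M.normal f)) (v t (M.macroOf f.1) x)
        ∂(M.facetMeasure f) -
      (∫ x, inner ℝ (potential γ (vhat t f x)) (M.normal f) ∂(M.facetMeasure f) -
      ∫ x, inner ℝ (potential γ (v t (M.macroOf f.1) x)) (M.normal f) ∂(M.facetMeasure f)) := by
    intro f hf
    have hvc : ContinuousOn (v t (M.macroOf f.1)) (M.facet f) :=
      (continuousOn_of_isPolyOn ((hsol.memV t ht).2 f.1)).mono (facet_subset_cell M f)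
    have hhc : ContinuousOn (vhat t f) (M.facet f) :=
      continuousOn_of_isPolyOn (hsol.memM t ht f hf).1
    have hva : ∀ x ∈ M.facet f, Admissible (v t (M.macroOf f.1) x) := fun x hx =>
      hsol.admissible t ht f.1 x (facet_subset_cell M f hx)
    have hha := hsol.admissible_hat t ht f hf
    rw [← integral_sub (hdot f hf _ hhc) (hdot f hf _ hvc),
      ← integral_sub (hpot f _ hhc hha) (hpot f _ hvc hva)]
    refine Eq.trans ?_ (integral_sub ((hdot f hf _ hhc).sub (hdot f hf _ hvc))
      ((hpot f _ hhc hha).sub (hpot f _ hvc hva)))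
    refine integral_congr_ae (ae_of_all _ fun x => ?_)
    simp only [entropyResidual, dot, inner_sub_left, Pi.sub_apply, ← Finset.sum_sub_distrib]
    congr 1
    exact Finset.sum_congr rfl fun c _ => by ring
  rw [Finset.sum_congr rfl hres]
  simp only [Finset.sum_sub_distrib]
  rw [htrans, hhat, ← hvol]
  linarith

end Entropy

end EulerHDG

end

/-! ### Entropy conservation and entropy stability -/

open EulerHDG
theorem theorem1 {d : ℕ} [NeZero d] {ι κ : Type*} [Fintype ι] (M : PeriodicMacroMesh d ι κ)
    (p : ℕ) (γ : ℝ) (hγ : 1 < γ) (Fhat : State d → State d → Space d → State d)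
    (T : ℝ) (hT : 0 < T) (v : ℝ → κ → Space d → State d)
    (vhat : ℝ → ι × Fin (d + 1) → Space d → State d)
    (hsol : IsSolution M p γ Fhat T v vhat) :
    ((∀ t ∈ Icc 0 T, ∀ f ∈ M.interfaceFacets, ∀ᵐ x ∂(M.facetMeasure f),
        entropyResidual γ Fhat (vhat t f x) (v t (M.macroOf f.1) x) (M.normal f) = 0) →
      EntropyConservative M γ T v) ∧
    ((∀ t ∈ Icc 0 T, ∀ f ∈ M.interfaceFacets, ∀ᵐ x ∂(M.facetMeasure f),
        entropyResidual γ Fhat (vhat t f x) (v t (M.macroOf f.1) x) (M.normal f) ≤ 0) →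
      EntropyStable M γ T v) := by
  refine ⟨fun h => ?_, fun h => ?_⟩
  · have hderiv : ∀ t ∈ Icc 0 T,
        HasDerivWithinAt (fun r => totalEntropy M γ (v r)) 0 (Icc 0 T) t := fun t ht =>
      (hsol.hasDerivWithinAt_totalEntropy hγ ht).congr_deriv
        (Finset.sum_eq_zero fun f hf => integral_eq_zero_of_ae (h t ht f hf))
    exact ⟨hderiv, constant_of_derivWithin_zero
      (fun t ht => (hderiv t ht).differentiableWithinAt) fun t ht =>
        (hderiv t (Ico_subset_Icc_self ht)).derivWithin
          (uniqueDiffOn_Icc hT t (Ico_subset_Icc_self ht))⟩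
  · have hderiv : ∀ t ∈ Icc 0 T, ∃ r ≤ 0,
        HasDerivWithinAt (fun r => totalEntropy M γ (v r)) r (Icc 0 T) t := fun t ht =>
      ⟨_, Finset.sum_nonpos fun f hf => integral_nonpos_of_ae (h t ht f hf),
        hsol.hasDerivWithinAt_totalEntropy hγ ht⟩
    refine ⟨hderiv, antitoneOn_of_deriv_nonpos (convex_Icc 0 T) (fun t ht => ?_)
      (fun t ht => ?_) fun t ht => ?_⟩
    · obtain ⟨r, -, hr⟩ := hderiv t ht
      exact hr.continuousWithinAt
    -- Monotonicity needs the sign of the derivative only inside the interval, where the derivative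
    -- within `[0,T]` is a genuine one.
    all_goals
      obtain ⟨r, hr0, hr⟩ := hderiv t (interior_subset ht)
      have hr' := hr.hasDerivAt (mem_interior_iff_mem_nhds.1 ht)
    · exact hr'.differentiableAt.differentiableWithinAt
    · rwa [hr'.deriv]
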